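/- Conventions. For a Noetherian commutative ring $A$ of finite Krull dimension $\delta$ and a submodule $N \subseteq F = A^r$ such that $F/N$ has finite length, let $F^n = \mathrm{Sym}_n(F)$ and let $N^n \subseteq F^n$ be the degree $n$ component of the image of $\mathrm{Sym}(N) \to \mathrm{Sym}(F)$. The Buchsbaum–Rim multiplicity of $N$ is $$br_A(N) = \lim_{n\to\infty} (\delta+r-1)!\,\frac{\lambda_A(F^n/N^n)}{n^{\delta+r-1}},$$ where $\lambda_A$ is the length of an $A$-module (if $\delta=r=0$, read $\delta+r-1$ as $0$). For an ideal $I \subseteq A$ with $A/I$ of finite length, its Hilbert–Samuel multiplicity is $\lim_{n\to\infty} \delta!\,\lambda_A(A/I^n)/n^{\delta}$. Proposition. Let $(R,m)$ be a Noetherian local ring of dimension $d$, and let $E \subseteq F = R^r$ be a submodule with $\lambda_R(F/E) < \infty$. Let $G = \mathrm{gr}_m(R) = \bigoplus_{i\ge 0} m^i/m^{i+1}$, let $G_+ = \bigoplus_{i \ge 1} m^i/m^{i+1}$, and let $$E^* = \bigoplus_{i\ge 0} \frac{E\cap m^iF + m^{i+1}F}{m^{i+1}F} \subseteq \mathrm{gr}_m(F)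 = G^r$$ be the module of leading forms of $E$. Let $e(R)$ be the Hilbert–Samuel multiplicity of $m$ and $e(G)$ that of $G_+$. Then the limits defining $br_R(mE)$, $br_G(G_+E^*)$, $e(R)$ and $e(G)$ exist and are finite, and $$br_R(mE) \le br_G(G_+E^*).$$ Furthermore, if $$br_G(G_+E^*) < \frac{(d+r-1)!}{r!}\,\lambda_G(\mathrm{gr}_m(F)/E^*)\,e(G),$$ then $$br_R(mE) < \frac{(d+r-1)!}{r!}\,\lambda_R(F/E)\,e(R).$$ -/

import Mathlib

open scoped ENNReal NNReal Nat

section AssociatedGraded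

universe u

variable {R : Type u} [CommRing R]

/-- The associated graded ring `gr_I(R) = ⨁ i, I ^ i / I ^ (i + 1)`, realised in the usual way as
`R[It] / I R[It]`, where `R[It] = ⨁ i, I ^ i t ^ i` is the Rees algebra of the ideal `I`. -/
def AssocGraded (I : Ideal R) : Type u :=
  reesAlgebra I ⧸ I.map (algebraMap R (reesAlgebra I))

noncomputable instance (I : Ideal R) : CommRing (AssocGraded I) :=
  Ideal.Quotient.commRing (I.map (algebraMap R (reesAlgebra I)))

/-- The quotient map `R[It] → gr_I(R)`. -/
noncomputable def AssocGraded.mk (I : Ideal R) : reesAlgebra I →+* AssocGraded I :=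
  Ideal.Quotient.mk (I.map (algebraMap R (reesAlgebra I)))

noncomputable instance (I : Ideal R) : Algebra R (AssocGraded I) :=
  ((AssocGraded.mk I).comp (algebraMap R (reesAlgebra I))).toAlgebra

/-- The map `I ^ i → gr_I(R)` that sends `a` to its class in the degree `i` part
`I ^ i / I ^ (i + 1)`, that is, to the class of `a t ^ i`. -/
noncomputable def gradedClass (I : Ideal R) (i : ℕ) : ↥(I ^ i) →ₗ[R] AssocGraded I where
  toFun a := AssocGraded.mk I ⟨Polynomial.monomial i (a : R), reesAlgebra.monomial_mem.mpr a.2⟩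
  map_add' a b := by
    rw [← map_add]
    congr 1
    ext1
    simp
  map_smul' c a := by
    rw [RingHom.id_apply, Algebra.smul_def]
    change _ = AssocGraded.mk I (algebraMap R (reesAlgebra I) c) * _
    rw [← map_mul]
    congr 1
    ext1
    simp [Polynomial.C_mul_monomial]

/-- The kernel of `I ^ i → gr_I(R)` is `I ^ (i + 1)`. -/
theorem gradedClass_eq_zero_iff (I : Ideal R) (i : ℕ) (a : ↥(I ^ i)) :
    gradedClass I i a = 0 ↔ (a : R) ∈ I ^ (i + 1) := by
  have key : ∀ f ∈ I.map (algebraMap R (reesAlgebra I)),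
      ∀ j, (f : Polynomial R).coeff j ∈ I ^ (j + 1) := by
    intro f hf
    refine Submodule.span_induction
      (p := fun (f : reesAlgebra I) _ => ∀ j, (f : Polynomial R).coeff j ∈ I ^ (j + 1))
      ?_ ?_ ?_ ?_ hf
    · rintro _ ⟨x, hx, rfl⟩ j
      change (Polynomial.C x).coeff j ∈ _
      rw [Polynomial.coeff_C]
      split_ifs with h
      · subst h
        simpa using hx
      · exact zero_mem _
    · intro j
      simp
    · intro x y _ _ hx hy j
      simpa using add_mem (hx j) (hy j)
    · intro c x _ hx j
      rw [smul_eq_mul, MulMemClass.coe_mul, Polynomial.coeff_mul]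
      refine Ideal.sum_mem _ ?_
      rintro ⟨k, l⟩ e
      rw [← Finset.HasAntidiagonal.mem_antidiagonal.mp e, add_assoc, pow_add]
      exact Ideal.mul_mem_mul (c.2 k) (hx l)
  refine ⟨fun h => by simpa using key _ (Ideal.Quotient.eq_zero_iff_mem.mp h) i, fun h => ?_⟩
  have h2 : I * I ^ i ≤ (LinearMap.ker (gradedClass I i)).map (Submodule.subtype (I ^ i)) := by
    refine Submodule.mul_le.mpr fun x hx y hy => ⟨x • ⟨y, hy⟩, ?_, rfl⟩
    change gradedClass I i (x • ⟨y, hy⟩) = 0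
    have hx0 : algebraMap R (AssocGraded I) x = 0 :=
      Ideal.Quotient.eq_zero_iff_mem.mpr (Ideal.mem_map_of_mem _ hx)
    rw [map_smul, Algebra.smul_def, hx0, zero_mul]
  obtain ⟨b, hb, hba⟩ := h2 (by rwa [pow_succ'] at h : (a : R) ∈ I * I ^ i)
  have hab : b = a := Subtype.ext hba
  subst hab
  exact hb

/-- The product in `gr_I(R)` of the classes of `a ∈ I ^ i` and `b ∈ I ^ j` is the class of `a b`
in degree `i + j`. -/
theorem gradedClass_mul (I : Ideal R) (i j : ℕ) (a : ↥(I ^ i)) (b : ↥(I ^ j)) :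
    gradedClass I i a * gradedClass I j b =
      gradedClass I (i + j) ⟨a * b, by rw [pow_add]; exact Ideal.mul_mem_mul a.2 b.2⟩ := by
  change AssocGraded.mk I _ * AssocGraded.mk I _ = AssocGraded.mk I _
  rw [← map_mul]
  congr 1
  ext1
  simp [Polynomial.monomial_mul_monomial]

/-- Every element of `gr_I(R)` is a sum of homogeneous ones. -/
theorem iSup_range_gradedClass (I : Ideal R) :
    ⨆ i, LinearMap.range (gradedClass I i) = ⊤ := by
  rw [eq_top_iff]
  rintro g -
  obtain ⟨f, rfl⟩ := Ideal.Quotient.mk_surjective g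
  have hf : f = ∑ i ∈ (f : Polynomial R).support,
      (⟨Polynomial.monomial i ((f : Polynomial R).coeff i),
        reesAlgebra.monomial_mem.mpr (f.2 i)⟩ : reesAlgebra I) := by
    ext1
    rw [AddSubmonoidClass.coe_finsetSum]
    exact (f : Polynomial R).as_sum_support
  change AssocGraded.mk I f ∈ _
  rw [hf, map_sum]
  refine Submodule.sum_mem _ fun i _ => Submodule.mem_iSup_of_mem i ?_
  exact ⟨⟨_, f.2 i⟩, rfl⟩

/-- The ideal `G₊ = ⨁ i ≥ 1, I ^ i / I ^ (i + 1)` of `G = gr_I(R)`. When `I` is the maximal ideal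
of a local ring this is the maximal homogeneous ideal of `G`. -/
noncomputable def irrelevantIdeal (I : Ideal R) : Ideal (AssocGraded I) :=
  Ideal.span {g | ∃ i, 1 ≤ i ∧ ∃ a : ↥(I ^ i), g = gradedClass I i a}

/-- For `E ⊆ F = R ^ r`, the degree `i` part `(E ∩ I ^ i F + I ^ (i + 1) F) / I ^ (i + 1) F` of
`E^*`, as a subset of `gr_I(F) = gr_I(R) ^ r`: the classes in degree `i` of the vectors of
`I ^ i F = (I ^ i) ^ r` that lie in `E`. -/
noncomputable def initialPart (I : Ideal R) {r : ℕ} (E : Submodule R (Fin r → R)) (i : ℕ) :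
    Submodule R (Fin r → AssocGraded I) :=
  (E.comap ((Submodule.subtype (I ^ i)).compLeft (Fin r))).map ((gradedClass I i).compLeft (Fin r))

/-- The module of leading forms `E^* = ⨁ i, (E ∩ I ^ i F + I ^ (i + 1) F) / I ^ (i + 1) F`, as a
`gr_I(R)`-submodule of `gr_I(F) = gr_I(R) ^ r`. -/
noncomputable def initialModule (I : Ideal R) {r : ℕ} (E : Submodule R (Fin r → R)) :
    Submodule (AssocGraded I) (Fin r → AssocGraded I) :=
  Submodule.span (AssocGraded I) {w | ∃ i, w ∈ initialPart I E i}

/-- No further elements arise from taking the `gr_I(R)`-span in the definition of `E^*`: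
it is the sum of the parts of degree `i`. -/
theorem initialModule_eq_iSup (I : Ideal R) {r : ℕ} (E : Submodule R (Fin r → R)) :
    (initialModule I E).restrictScalars R = ⨆ i, initialPart I E i := by
  apply le_antisymm
  · intro w hw
    refine Submodule.span_induction (p := fun w _ => w ∈ ⨆ i, initialPart I E i)
      (fun w hi => hi.elim fun i hi => Submodule.mem_iSup_of_mem i hi) (zero_mem _)
      (fun _ _ _ _ hx hy => add_mem hx hy) (fun g x _ hx => ?_) hw
    have hg : g ∈ ⨆ i, LinearMap.range (gradedClass I i) := by simp [iSup_range_gradedClass]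
    refine Submodule.iSup_induction _ (motive := fun g => g • x ∈ ⨆ i, initialPart I E i) hg
      ?_ (by simp) fun a b ha hb => by rw [add_smul]; exact add_mem ha hb
    intro j g hg
    obtain ⟨a, rfl⟩ := hg
    refine Submodule.iSup_induction _
      (motive := fun x => gradedClass I j a • x ∈ ⨆ i, initialPart I E i) hx ?_ (by simp)
      fun a b ha hb => by rw [smul_add]; exact add_mem ha hb
    intro i x hx
    obtain ⟨v, hv, rfl⟩ := hx
    refine Submodule.mem_iSup_of_mem (j + i)
      ⟨fun k => ⟨a * v k, by rw [pow_add]; exact Ideal.mul_mem_mul a.2 (v k).2⟩, ?_, ?_⟩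
    · exact E.smul_mem (a : R) hv
    · funext k
      exact (gradedClass_mul I j i a (v k)).symm
  · exact iSup_le fun i w hw => Submodule.subset_span ⟨i, hw⟩

end AssociatedGraded

section Multiplicities

variable {A : Type*} [CommRing A]

/-- The degree `n` component `Sym_n(M)` of the symmetric algebra of `M`. -/
noncomputable def symPart (A : Type*) [CommRing A] (M : Type*) [AddCommGroup M] [Module A M]
    (n : ℕ) : Submodule A (SymmetricAlgebra A M) :=
  LinearMap.range (SymmetricAlgebra.ι A M) ^ n

/-- For a submodule `E ⊆ F`, the degree `n` component `E ^ n` of the Rees algebra of `E`, the image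
of the natural map `Sym(E) → Sym(F)`. -/
noncomputable def reesPart {F : Type*} [AddCommGroup F] [Module A F] (E : Submodule A F) (n : ℕ) :
    Submodule A (SymmetricAlgebra A F) :=
  (symPart A E n).map
    (SymmetricAlgebra.lift (SymmetricAlgebra.ι A F ∘ₗ E.subtype)).toLinearMap

/-- `E ^ n` is the `n`-th power, in `Sym(F)`, of the copy of `E` in degree one. -/
theorem reesPart_eq_pow {F : Type*} [AddCommGroup F] [Module A F] (E : Submodule A F) (n : ℕ) :
    reesPart E n = E.map (SymmetricAlgebra.ι A F) ^ n := by
  unfold reesPart symPart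
  rw [Submodule.map_pow, ← LinearMap.range_comp]
  congr 1
  exact (congrArg LinearMap.range (SymmetricAlgebra.lift_comp_ι _)).trans
    (by rw [LinearMap.range_comp, Submodule.range_subtype])

/-- The length of `F ^ n / E ^ n`, where `F ^ n = Sym_n(F)`. -/
noncomputable def reesColength {F : Type*} [AddCommGroup F] [Module A F] (E : Submodule A F)
    (n : ℕ) : ℕ∞ :=
  Module.length A (symPart A F n ⧸ (reesPart E n).submoduleOf (symPart A F n))

/-- `b` is the Buchsbaum-Rim multiplicity `br_A(E)` of `E ⊆ F = A ^ r`: with `d = dim A`, it is the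
limit of `(d + r - 1)! λ(F ^ n / E ^ n) / n ^ (d + r - 1)` as `n → ∞`. -/
def IsBuchsbaumRimMultiplicity {r : ℕ} (E : Submodule A (Fin r → A)) (b : ℝ≥0) : Prop :=
  ∃ d : ℕ, ringKrullDim A = d ∧
    Filter.Tendsto (fun n : ℕ => ((d + r - 1)! : ℝ≥0∞) * (reesColength E n : ℝ≥0∞) /
      (n : ℝ≥0∞) ^ (d + r - 1)) Filter.atTop (nhds (b : ℝ≥0∞))

/-- `e` is the Hilbert-Samuel multiplicity of the ideal `I` of `A`: with `d = dim A`, it is the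
limit of `d! λ(A / I ^ n) / n ^ d` as `n → ∞`. -/
def IsHilbertSamuelMultiplicity (I : Ideal A) (e : ℝ≥0) : Prop :=
  ∃ d : ℕ, ringKrullDim A = d ∧
    Filter.Tendsto (fun n : ℕ => (d ! : ℝ≥0∞) * (Module.length A (A ⧸ I ^ n) : ℝ≥0∞) /
      (n : ℝ≥0∞) ^ d) Filter.atTop (nhds (e : ℝ≥0∞))

end Multiplicities

/-!
The inequality `br_R(mE) ≤ br_G(G₊E^*)` holds term by term. Realise `Sym_n(F)` as the forms of
degree `n` in a polynomial ring over `R`, and filter it by the powers of `m` in the coefficients.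
Taking leading forms sends the `R`-submodules between `(mE)^n` and `F^n` to `G`-submodules of the
forms of degree `n` over `G = gr_m(R)`, it is compatible with products, so that the leading forms of
`(mE)^n` contain `(G₊E^*)^n` (`leadingForms_pow_le`, `linearForm_mem_leadingForms`), and it is
strictly monotone, because `(mE)^n` contains a power of `m` times `F^n`
(`exists_coeff_sub_mem_pow`). A strictly increasing chain over `R` thus yields one over `G`, and
`λ_R(F^n / (mE)^n) ≤ λ_G(F_G^n / (G₊E^*)^n)` (`reesColength_le`). Conversely
`λ_G(gr_m(F) / E^*) ≤ λ_R(F / E)` and `λ_G(G / G₊^n) ≤ λ_R(R / m^n)`, by adding up the graded pieces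
(`length_quotient_initialModule_le`, `length_quotient_irrelevantIdeal_pow_le`). As `dim G = dim R`,
the limits compare in the same way, and the second assertion follows from the first.

It remains to see that the limits exist and that `dim G = dim R`.

* For finitely generated modules `N ≤ H` in a commutative algebra, `λ(H^n / N^n)` is the sum of the
  lengths of the subquotients `N^i H^(n-i) / N^(i+1) H^(n-i-1)`, which form the degree `n` part of
  a finitely generated graded module, so it is a polynomial in `n` for large `n`
  (`eventuallyPolynomial_relLength_pow`). The graded modules that occur are subquotients
  `L n / L' n` of a fixed algebra, which keeps Hilbert's argument free of direct sums
  (`eventuallyPolynomial_relLength`, `eventuallyGenerated_of_le_pow`).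
* The length of `A / M^n` is `O(n^s)` for a maximal ideal `M` of height `s`, by the existence of `s`
  parameters (`exists_length_quotient_maximal_pow_le`). This bounds the degrees of the polynomials
  above, so that the limits are finite.
* If the lengths of `R / m^n`, or those of the pieces of an exhaustive filtration of an algebra, are
  `O(n^e)`, then the dimension is at most `e`: along a chain of primes each step takes a difference
  of the growth function (`exists_pow_le_of_ltSeries`). The first case gives `dim R ≤ ht G₊ ≤ dim G`
  and the second `dim G ≤ dim R` (`ringKrullDim_assocGraded`).
-/

namespace BuchsbaumRim

open Filter Topology

/-! ### Relative lengths -/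

/-- The length of `Q / P` for submodules `P ≤ Q` of a module (in general, of `Q / (P ⊓ Q)`). -/
noncomputable def relLength {A M : Type*} [Ring A] [AddCommGroup M] [Module A M]
    (P Q : Submodule A M) : ℕ∞ :=
  Module.length A (Q ⧸ P.submoduleOf Q)

section RelLength

variable {A M N : Type*} [Ring A] [AddCommGroup M] [Module A M] [AddCommGroup N] [Module A N]

theorem relLength_top (P : Submodule A M) : relLength P ⊤ = Module.length A (M ⧸ P) :=
  (Submodule.Quotient.equiv _ _ Submodule.topEquiv (by
    ext x
    simp [Submodule.submoduleOf])).length_eq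

/-- `Q / (Q ∩ f⁻¹ P) ≅ (P + f Q) / P`. -/
theorem relLength_inf_comap (f : M →ₗ[A] N) (Q : Submodule A M) (P : Submodule A N) :
    relLength (Q ⊓ P.comap f) Q = relLength P (P ⊔ Q.map f) := by
  let g : Q →ₗ[A] (↥(P ⊔ Q.map f) ⧸ P.submoduleOf (P ⊔ Q.map f)) :=
    (P.submoduleOf _).mkQ ∘ₗ
      (f ∘ₗ Q.subtype).codRestrict (P ⊔ Q.map f)
        (fun x => Submodule.mem_sup_right ⟨x, x.2, rfl⟩)
  have hk : (Q ⊓ P.comap f).submoduleOf Q = LinearMap.ker g := by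
    ext x
    rw [LinearMap.mem_ker]
    change _ ↔ Submodule.Quotient.mk _ = _
    rw [Submodule.Quotient.mk_eq_zero]
    simp [Submodule.submoduleOf]
  have hg : Function.Surjective g := by
    intro y
    obtain ⟨⟨y, hy⟩, rfl⟩ := Submodule.Quotient.mk_surjective _ y
    obtain ⟨p, hp, _, ⟨q, hq, rfl⟩, rfl⟩ := Submodule.mem_sup.mp hy
    refine ⟨⟨q, hq⟩, ?_⟩
    refine (Submodule.Quotient.eq _).mpr ?_
    simpa [Submodule.submoduleOf] using hp
  exact ((Submodule.quotEquivOfEq _ _ hk).trans (g.quotKerEquivOfSurjective hg)).length_eq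

/-- A submodule and its intersection with the larger one have the same relative length. -/
theorem relLength_inf (P Q : Submodule A M) : relLength (Q ⊓ P) Q = relLength P Q := by
  unfold relLength
  congr 2 <;> simp [Submodule.submoduleOf]

theorem relLength_sup (P Q : Submodule A M) : relLength P (P ⊔ Q) = relLength P Q := by
  have := relLength_inf_comap (LinearMap.id) Q P
  simpa [relLength_inf] using this.symm

theorem relLength_self (P : Submodule A M) : relLength P P = 0 := by
  unfold relLength
  rw [Submodule.submoduleOf_self]
  exact Module.length_eq_zero

/-- The relative length is additive along `P ≤ Q ≤ T`. -/
theorem relLength_add {P Q T : Submodule A M} (hPQ : P ≤ Q) (hQT : Q ≤ T) :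
    relLength P Q + relLength Q T = relLength P T := by
  let f : (Q ⧸ P.submoduleOf Q) →ₗ[A] (T ⧸ P.submoduleOf T) :=
    Submodule.mapQ _ _ (Submodule.inclusion hQT) (fun x hx => hx)
  let g : (T ⧸ P.submoduleOf T) →ₗ[A] (T ⧸ Q.submoduleOf T) :=
    Submodule.mapQ _ _ LinearMap.id (fun x hx => hPQ hx)
  refine (Module.length_eq_add_of_exact f g ?_ ?_ ?_).symm
  · rw [← LinearMap.ker_eq_bot, LinearMap.ker_eq_bot']
    intro x hx
    obtain ⟨x, rfl⟩ := Submodule.Quotient.mk_surjective _ x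
    have hx' : (x : M) ∈ P :=
      (Submodule.Quotient.mk_eq_zero (P.submoduleOf T) (x := Submodule.inclusion hQT x)).mp hx
    exact (Submodule.Quotient.mk_eq_zero _).mpr hx'
  · intro x
    obtain ⟨x, rfl⟩ := Submodule.Quotient.mk_surjective _ x
    exact ⟨Submodule.Quotient.mk x, rfl⟩
  · intro x
    obtain ⟨x, rfl⟩ := Submodule.Quotient.mk_surjective _ x
    constructor
    · intro hx
      have hx' : (x : M) ∈ Q := (Submodule.Quotient.mk_eq_zero (Q.submoduleOf T)).mp hx
      exact ⟨Submodule.Quotient.mk ⟨x, hx'⟩, rfl⟩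
    · rintro ⟨y, hy⟩
      obtain ⟨y, rfl⟩ := Submodule.Quotient.mk_surjective _ y
      rw [← hy]
      exact (Submodule.Quotient.mk_eq_zero _).mpr y.2

theorem relLength_anti_left {P P' : Submodule A M} (h : P ≤ P') (Q : Submodule A M) :
    relLength P' Q ≤ relLength P Q := by
  rw [← relLength_inf P Q, ← relLength_inf P' Q,
    ← relLength_add (inf_le_inf_left Q h) inf_le_left]
  exact le_add_self

theorem relLength_mono_right (P : Submodule A M) {Q Q' : Submodule A M} (h : Q ≤ Q') :
    relLength P Q ≤ relLength P Q' := by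
  rw [← relLength_sup P Q, ← relLength_sup P Q',
    ← relLength_add le_sup_left (sup_le_sup_left h P)]
  exact le_self_add

/-- If `f` maps `Q` onto a submodule that spans `Q'` modulo `P'`, and maps `P` into `P'`, then the
relative length of `P' ≤ Q'` is at most that of `P ≤ Q`. -/
theorem relLength_le_of_map (f : M →ₗ[A] N) {P Q : Submodule A M} {P' Q' : Submodule A N}
    (hP : P.map f ≤ P') (hQ : Q' ≤ P' ⊔ Q.map f) : relLength P' Q' ≤ relLength P Q :=
  calc relLength P' Q' ≤ relLength P' (P' ⊔ Q.map f) := relLength_mono_right _ hQ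
    _ = relLength (P'.comap f) Q := by rw [← relLength_inf_comap, relLength_inf]
    _ ≤ relLength P Q := relLength_anti_left (Submodule.map_le_iff_le_comap.mp hP) Q

theorem relLength_map_equiv (e : M ≃ₗ[A] N) (P Q : Submodule A M) :
    relLength (P.map (e : M →ₗ[A] N)) (Q.map (e : M →ₗ[A] N)) = relLength P Q := by
  refine le_antisymm (relLength_le_of_map (e : M →ₗ[A] N) le_rfl le_sup_right)
    (relLength_le_of_map (e.symm : N →ₗ[A] M) ?_ ?_)
  · rintro _ ⟨_, ⟨x, hx, rfl⟩, rfl⟩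
    simpa using hx
  · exact fun x hx => Submodule.mem_sup_right ⟨e x, ⟨x, hx, rfl⟩, by simp⟩

/-- Additivity along a finite chain. -/
theorem sum_relLength (W : ℕ → Submodule A M) (n : ℕ) (hW : ∀ i < n, W (i + 1) ≤ W i) :
    ∑ i ∈ Finset.range n, relLength (W (i + 1)) (W i) = relLength (W n) (W 0) := by
  suffices h : W n ≤ W 0 ∧
      ∑ i ∈ Finset.range n, relLength (W (i + 1)) (W i) = relLength (W n) (W 0) from h.2
  induction n with
  | zero => simp [relLength_self]
  | succ n ih =>
    obtain ⟨h1, h2⟩ := ih fun i hi => hW i (by omega)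
    have h3 := hW n (by omega)
    exact ⟨h3.trans h1, by rw [Finset.sum_range_succ, h2, add_comm, relLength_add h3 h1]⟩

/-- The relative length of `P ≤ Q` is the Krull dimension of the interval `[P, Q]`. -/
theorem coe_relLength {P Q : Submodule A M} (h : P ≤ Q) :
    (relLength P Q : WithBot ℕ∞) = Order.krullDim (Set.Icc P Q) := by
  unfold relLength
  rw [Module.coe_length]
  have e1 : Submodule A (Q ⧸ P.submoduleOf Q) ≃o Set.Ici (P.submoduleOf Q) :=
    Submodule.comapMkQRelIso _
  let e2 : Set.Ici (P.submoduleOf Q) ≃o Set.Icc P Q :=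
    { toFun := fun X => ⟨X.1.map Q.subtype,
        by
          have := Submodule.map_mono (f := Q.subtype) X.2
          rwa [show (P.submoduleOf Q).map Q.subtype = P by
            rw [Submodule.submoduleOf, Submodule.map_comap_subtype, inf_eq_right.mpr h]] at this,
        Submodule.map_subtype_le _ _⟩
      invFun := fun X => ⟨X.1.submoduleOf Q, Submodule.comap_mono X.2.1⟩
      left_inv := fun X => Subtype.ext
        (Submodule.comap_map_eq_of_injective Q.injective_subtype X.1)
      right_inv := fun X => Subtype.ext (by
        simpa [Submodule.submoduleOf, Submodule.map_comap_subtype] using X.2.2)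
      map_rel_iff' := by
        intro X Y
        exact Submodule.map_le_map_iff_of_injective Q.injective_subtype _ _ }
  exact Order.krullDim_eq_of_orderIso (e1.trans e2)

end RelLength

/-- A strictly monotone map between intervals of submodules, possibly over different rings, does not
decrease lengths. -/
theorem relLength_le_of_strictMono {A B M N : Type*} [Ring A] [AddCommGroup M] [Module A M]
    [Ring B] [AddCommGroup N] [Module B N] {P Q : Submodule A M} {P' Q' : Submodule B N}
    (h : P ≤ Q) (Φ : Submodule A M → Submodule B N)
    (hΦ : ∀ X, P ≤ X → X ≤ Q → P' ≤ Φ X ∧ Φ X ≤ Q')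
    (hmono : ∀ X Y, P ≤ X → X ≤ Y → Y ≤ Q → Φ X ≤ Φ Y)
    (hrefl : ∀ X Y, P ≤ X → X ≤ Y → Y ≤ Q → Φ Y ≤ Φ X → Y ≤ X) :
    relLength P Q ≤ relLength P' Q' := by
  have h' : P' ≤ Q' := (hΦ P le_rfl h).1.trans (hΦ P le_rfl h).2
  have : (relLength P Q : WithBot ℕ∞) ≤ relLength P' Q' := by
    rw [coe_relLength h, coe_relLength h']
    refine Order.krullDim_le_of_strictMono
      (fun X : Set.Icc P Q => (⟨Φ X.1, hΦ X.1 X.2.1 X.2.2⟩ : Set.Icc P' Q')) ?_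
    intro X Y hXY
    refine lt_of_le_not_ge (hmono _ _ X.2.1 hXY.le Y.2.2) fun hle => ?_
    exact hXY.not_ge (hrefl _ _ X.2.1 hXY.le Y.2.2 hle)
  exact_mod_cast this

/-- Over a smaller ring of scalars lengths can only grow. -/
theorem relLength_le_restrictScalars (A : Type*) {B M : Type*} [Ring A] [Ring B] [SMul A B]
    [AddCommGroup M] [Module A M] [Module B M] [IsScalarTower A B M] (P Q : Submodule B M) :
    relLength P Q ≤ relLength (P.restrictScalars A) (Q.restrictScalars A) := by
  rw [← relLength_sup, ← relLength_sup (P.restrictScalars A)]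
  refine relLength_le_of_strictMono le_sup_left (fun X => X.restrictScalars A)
    (fun X h1 h2 => ⟨h1, ?_⟩) (fun X Y _ h _ => h) (fun X Y _ _ _ h => h)
  intro x hx
  obtain ⟨p, hp, q, hq, rfl⟩ := Submodule.mem_sup.mp (h2 hx)
  exact add_mem (Submodule.mem_sup_left hp) (Submodule.mem_sup_right hq)

/-! ### Hilbert functions of graded subquotients of an algebra -/

/-- A sequence of rationals that agrees with a polynomial for all large arguments. -/
def EventuallyPolynomial (f : ℕ → ℚ) : Prop :=
  ∃ p : Polynomial ℚ, ∀ᶠ n : ℕ in atTop, f n = p.eval (n : ℚ)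

theorem EventuallyPolynomial.sub {f g : ℕ → ℚ} (hf : EventuallyPolynomial f)
    (hg : EventuallyPolynomial g) : EventuallyPolynomial (fun n => f n - g n) := by
  obtain ⟨p, hp⟩ := hf
  obtain ⟨q, hq⟩ := hg
  refine ⟨p - q, ?_⟩
  filter_upwards [hp, hq] with n h1 h2
  rw [h1, h2, Polynomial.eval_sub]

theorem exists_polynomial_sub_eq (q : Polynomial ℚ) :
    ∃ p : Polynomial ℚ, ∀ n : ℕ, p.eval ((n + 1 : ℕ) : ℚ) - p.eval (n : ℚ) = q.eval (n : ℚ) := by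
  induction q using Polynomial.induction_on' with
  | add q₁ q₂ h₁ h₂ =>
    obtain ⟨p₁, h₁⟩ := h₁
    obtain ⟨p₂, h₂⟩ := h₂
    refine ⟨p₁ + p₂, fun n => ?_⟩
    rw [Polynomial.eval_add, Polynomial.eval_add, Polynomial.eval_add, ← h₁, ← h₂]
    ring
  | monomial k a =>
    let s : Polynomial ℚ := ∑ i ∈ Finset.range (k + 1),
      Polynomial.C (bernoulli i * ((k + 1).choose i) / (k + 1)) * Polynomial.X ^ (k + 1 - i)
    have hs : ∀ n : ℕ, s.eval (n : ℚ) = ∑ j ∈ Finset.range n, (j : ℚ) ^ k := by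
      intro n
      rw [sum_range_pow, Polynomial.eval_finsetSum]
      refine Finset.sum_congr rfl fun i _ => ?_
      simp only [Polynomial.eval_mul, Polynomial.eval_C, Polynomial.eval_pow, Polynomial.eval_X]
      ring
    refine ⟨Polynomial.C a * s, fun n => ?_⟩
    rw [Polynomial.eval_mul, Polynomial.eval_mul, hs, hs, Finset.sum_range_succ,
      Polynomial.eval_monomial, Polynomial.eval_C, Polynomial.eval_C]
    ring

theorem EventuallyPolynomial.of_sub {f : ℕ → ℚ}
    (h : EventuallyPolynomial (fun n => f (n + 1) - f n)) : EventuallyPolynomial f := by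
  obtain ⟨q, hq⟩ := h
  obtain ⟨p, hp⟩ := exists_polynomial_sub_eq q
  obtain ⟨n₀, h₀⟩ := eventually_atTop.mp hq
  refine ⟨p + Polynomial.C (f n₀ - p.eval (n₀ : ℚ)), eventually_atTop.mpr ⟨n₀, fun n hn => ?_⟩⟩
  induction n, hn using Nat.le_induction with
  | base => simp
  | succ n hn ih =>
    have h1 := h₀ n hn
    have h2 := hp n
    simp only [Polynomial.eval_add, Polynomial.eval_C] at ih ⊢
    linarith

section Hilbert

variable {A V : Type*} [CommRing A] [CommRing V] [Algebra A V]

/-- The graded module `⨁ n, L n / L' n` is Noetherian over the polynomial ring in the variables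
`xs`, in the following sense: every family `K` of submodules between `L'` and `L` that is stable
under multiplication by `xs` is generated in bounded degree. -/
def EventuallyGenerated (xs : Set V) (L' L : ℕ → Submodule A V) : Prop :=
  ∀ K : ℕ → Submodule A V, (∀ n, L' n ≤ K n) → (∀ n, K n ≤ L n) →
    (∀ n, Submodule.span A xs * K n ≤ K (n + 1)) →
    ∃ n₀, ∀ n, n₀ ≤ n → K (n + 1) ≤ L' (n + 1) ⊔ Submodule.span A xs * K n

/-- Hilbert's theorem on Hilbert functions: the length of the degree `n` part of a Noetherian graded
module is a polynomial in `n` for large `n`. The induction on the number of variables uses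
the kernel and the cokernel of multiplication by the last variable. -/
theorem eventuallyPolynomial_relLength (xs : Finset V) :
    ∀ L' L : ℕ → Submodule A V, (∀ n, L' n ≤ L n) →
      (∀ n, Submodule.span A (xs : Set V) * L' n ≤ L' (n + 1)) →
      (∀ n, Submodule.span A (xs : Set V) * L n ≤ L (n + 1)) →
      (∀ n, relLength (L' n) (L n) ≠ ⊤) → EventuallyGenerated (xs : Set V) L' L →
      EventuallyPolynomial (fun n => ((relLength (L' n) (L n)).toNat : ℚ)) := by
  classical
  induction xs using Finset.induction_on with
  | empty =>
    intro L' L hle hL' hL hfin hgen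
    obtain ⟨n₀, h₀⟩ := hgen L hle (fun _ => le_rfl) hL
    refine ⟨0, eventually_atTop.mpr ⟨n₀ + 1, fun n hn => ?_⟩⟩
    obtain ⟨n, rfl⟩ : ∃ k, n = k + 1 := ⟨n - 1, by omega⟩
    have h1 : L (n + 1) = L' (n + 1) :=
      le_antisymm (by simpa using h₀ n (by omega)) (hle _)
    simp [h1, relLength_self]
  | insert y xs hy ih =>
    intro L' L hle hL' hL hfin hgen
    rw [Finset.coe_insert] at hL' hL hgen
    have hspan : ∀ P : Submodule A V, Submodule.span A (insert y (xs : Set V)) * P =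
        P.map (LinearMap.mulLeft A y) ⊔ Submodule.span A (xs : Set V) * P := by
      intro P
      rw [Submodule.span_insert, Submodule.sup_mul]
      congr 1
      ext v
      simp [Submodule.mem_span_singleton_mul]
    simp only [hspan, sup_le_iff] at hL' hL
    -- the kernel and the image of multiplication by `y` on `L / L'`
    let K : ℕ → Submodule A V := fun n => L n ⊓ (L' (n + 1)).comap (LinearMap.mulLeft A y)
    let I : ℕ → Submodule A V := fun n => L' (n + 1) ⊔ (L n).map (LinearMap.mulLeft A y)
    have hL'K : ∀ n, L' n ≤ K n := fun n =>
      le_inf (hle n) (Submodule.map_le_iff_le_comap.mp (hL' n).1)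
    have hIL : ∀ n, I n ≤ L (n + 1) := fun n => sup_le (hle _) (hL n).1
    have hcomm : ∀ P : Submodule A V, Submodule.span A (xs : Set V) *
        P.map (LinearMap.mulLeft A y) =
        (Submodule.span A (xs : Set V) * P).map (LinearMap.mulLeft A y) := by
      intro P
      have : ∀ Q : Submodule A V, Q.map (LinearMap.mulLeft A y) = Submodule.span A {y} * Q := by
        intro Q
        ext v
        simp [Submodule.mem_span_singleton_mul]
      rw [this, this, mul_left_comm]
    have hker : EventuallyPolynomial (fun n => ((relLength (L' n) (K n)).toNat : ℚ)) := by
      refine ih L' K hL'K (fun n => (hL' n).2) (fun n => ?_) (fun n => ?_) ?_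
      · refine le_inf ((mul_le_mul' le_rfl inf_le_left).trans (hL n).2) ?_
        rw [← Submodule.map_le_iff_le_comap, ← hcomm]
        refine (mul_le_mul' le_rfl ?_).trans (hL' (n + 1)).2
        exact Submodule.map_le_iff_le_comap.mpr inf_le_right
      · exact ne_top_of_le_ne_top (hfin n) (relLength_mono_right _ inf_le_left)
      · intro J h1 h2 h3
        have hyJ : ∀ n, (J n).map (LinearMap.mulLeft A y) ≤ L' (n + 1) := fun n =>
          Submodule.map_le_iff_le_comap.mpr ((h2 n).trans inf_le_right)
        obtain ⟨n₀, h₀⟩ := hgen J h1 (fun n => (h2 n).trans inf_le_left) (fun n => by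
          rw [hspan]
          exact sup_le ((hyJ n).trans (h1 _)) (h3 n))
        refine ⟨n₀, fun n hn => (h₀ n hn).trans ?_⟩
        rw [hspan]
        exact sup_le le_sup_left (sup_le ((hyJ n).trans le_sup_left) le_sup_right)
    have hcoker : EventuallyPolynomial
        (fun n => ((relLength (I n) (L (n + 1))).toNat : ℚ)) := by
      refine ih I (fun n => L (n + 1)) hIL (fun n => ?_) (fun n => (hL (n + 1)).2)
        (fun n => ?_) ?_
      · change _ * (_ ⊔ _) ≤ _
        rw [Submodule.mul_sup, hcomm]
        exact sup_le_sup (hL' _).2 (Submodule.map_mono (hL n).2)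
      · exact ne_top_of_le_ne_top (hfin (n + 1)) (relLength_anti_left le_sup_left _)
      · intro J h1 h2 h3
        -- `J` is shifted by one degree, and continued by `L'` in degree zero
        let J' : ℕ → Submodule A V := fun n => Nat.casesOn n (L' 0) J
        have hJ'L : ∀ n, J' n ≤ L n := fun n => by
          cases n with
          | zero => exact hle 0
          | succ n => exact h2 n
        have hJ' : ∀ n, L' n ≤ J' n := fun n => by
          cases n with
          | zero => exact le_rfl
          | succ n => exact le_sup_left.trans (h1 n)
        have hyJ : ∀ n, (J' n).map (LinearMap.mulLeft A y) ≤ I n := fun n =>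
          (Submodule.map_mono (hJ'L n)).trans le_sup_right
        obtain ⟨n₀, h₀⟩ := hgen J' hJ' hJ'L (fun n => by
          rw [hspan]
          refine sup_le ((hyJ n).trans (h1 n)) ?_
          cases n with
          | zero => exact (hL' 0).2.trans (le_sup_left.trans (h1 0))
          | succ n => exact h3 n)
        refine ⟨n₀, fun n hn => (h₀ (n + 1) (by omega)).trans ?_⟩
        rw [hspan]
        exact sup_le (le_sup_left.trans le_sup_left)
          (sup_le ((hyJ (n + 1)).trans le_sup_left) le_sup_right)
    refine EventuallyPolynomial.of_sub ?_
    convert hcoker.sub hker using 2 with n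
    have e1 := relLength_add (hL'K n) (inf_le_left : K n ≤ L n)
    have e2 := relLength_add (le_sup_left : L' (n + 1) ≤ I n) (hIL n)
    have e3 : relLength (K n) (L n) = relLength (L' (n + 1)) (I n) := relLength_inf_comap _ _ _
    have f1 := hfin n
    have f2 := hfin (n + 1)
    rw [← e1] at f1 ⊢
    rw [← e2] at f2 ⊢
    rw [← e3] at f2 ⊢
    rw [ENat.toNat_add (ne_top_of_le_ne_top f1 le_self_add)
        (ne_top_of_le_ne_top f1 le_add_self), ENat.toNat_add
        (ne_top_of_le_ne_top f2 le_self_add) (ne_top_of_le_ne_top f2 le_add_self)]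
    push_cast
    ring

/-- A form of Hilbert's basis theorem: a family of subspaces of the powers `X ^ n` of the span `X`
of finitely many elements, stable under multiplication by `X`, is generated in bounded degree. -/
theorem eventuallyGenerated_of_le_pow [IsNoetherianRing A] (xs : Finset V)
    (L' L : ℕ → Submodule A V)
    (hL : ∀ n, L n ≤ Submodule.span A (xs : Set V) ^ n) :
    EventuallyGenerated (xs : Set V) L' L := by
  intro K _ hKL hK
  let ev : MvPolynomial xs A →ₐ[A] V := MvPolynomial.aeval (fun x : xs => (x : V))
  -- the ideal generated by the forms of degree at most `n` that represent elements of `K`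
  let I : ℕ →o Ideal (MvPolynomial xs A) :=
    { toFun := fun n => Ideal.span {p | ∃ j ≤ n, p.IsHomogeneous j ∧ ev p ∈ K j}
      monotone' := fun m n hmn => Ideal.span_mono fun p ⟨j, hj, h⟩ => ⟨j, hj.trans hmn, h⟩ }
  obtain ⟨n₀, h₀⟩ := monotone_stabilizes_iff_noetherian.mpr
    (inferInstance : IsNoetherianRing (MvPolynomial xs A)) I
  have hmon : ∀ (s : xs →₀ ℕ) (a : A) (j : ℕ) (g : MvPolynomial xs A), ev g ∈ K j →
      ev (MvPolynomial.monomial s a * g) ∈ K (j + s.degree) := by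
    intro s
    induction s using Finsupp.induction_linear with
    | zero =>
      intro a j g hg
      have := (K j).smul_mem a hg
      simpa [Algebra.smul_def, ev] using this
    | add s t hs ht =>
      intro a j g hg
      have h1 := hs a _ _ (ht 1 j g hg)
      rw [← mul_assoc, MvPolynomial.monomial_mul, mul_one] at h1
      rw [map_add, add_comm s.degree, ← add_assoc]
      exact h1
    | single i k =>
      intro a j g hg
      rw [Finsupp.degree_single]
      induction k generalizing a with
      | zero =>
        have := (K j).smul_mem a hg
        simpa [Algebra.smul_def, ev] using this
      | succ k ih =>
        have h1 : (i : V) * ev (MvPolynomial.monomial (Finsupp.single i k) a * g) ∈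
            K (j + k + 1) :=
          hK _ (Submodule.mul_mem_mul (Submodule.subset_span i.2) (ih a))
        have h2 : MvPolynomial.monomial (Finsupp.single i (k + 1)) a =
            MvPolynomial.X i * MvPolynomial.monomial (Finsupp.single i k) a := by
          rw [MvPolynomial.X, MvPolynomial.monomial_mul, one_mul, ← Finsupp.single_add,
            add_comm]
        rw [h2, mul_assoc, map_mul]
        simpa [ev, add_assoc] using h1
  refine ⟨n₀, fun n hn v hv => Submodule.mem_sup_right ?_⟩
  have hpow : ∀ m, ∀ v ∈ Submodule.span A (xs : Set V) ^ m,
      ∃ p : MvPolynomial xs A, p.IsHomogeneous m ∧ ev p = v := by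
    intro m
    induction m with
    | zero =>
      intro v hv
      rw [pow_zero] at hv
      obtain ⟨a, rfl⟩ := Submodule.mem_one.mp hv
      exact ⟨MvPolynomial.C a, MvPolynomial.isHomogeneous_C _ _, by simp [ev]⟩
    | succ m ih =>
      intro v hv
      rw [pow_succ] at hv
      refine Submodule.mul_induction_on hv (fun a ha b hb => ?_) (fun a b => ?_)
      · obtain ⟨p, hp, rfl⟩ := ih a ha
        have : ∃ q : MvPolynomial xs A, q.IsHomogeneous 1 ∧ ev q = b := by
          refine Submodule.span_induction (fun x hx => ?_) ?_ ?_ ?_ hb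
          · exact ⟨MvPolynomial.X ⟨x, hx⟩, MvPolynomial.isHomogeneous_X _ _, by simp [ev]⟩
          · exact ⟨0, MvPolynomial.isHomogeneous_zero _ _ _, map_zero _⟩
          · rintro _ _ _ _ ⟨p, hp, rfl⟩ ⟨q, hq, rfl⟩
            exact ⟨p + q, hp.add hq, map_add _ _ _⟩
          · rintro c _ _ ⟨p, hp, rfl⟩
            exact ⟨c • p, (MvPolynomial.homogeneousSubmodule _ _ _).smul_mem c hp, map_smul _ _ _⟩
        obtain ⟨q, hq, rfl⟩ := this
        exact ⟨p * q, hp.mul hq, map_mul _ _ _⟩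
      · rintro ⟨p, hp, rfl⟩ ⟨q, hq, rfl⟩
        exact ⟨p + q, hp.add hq, map_add _ _ _⟩
  obtain ⟨p, hp, rfl⟩ := hpow (n + 1) v (hL _ (hKL _ hv))
  have hpI : p ∈ I n := by
    have h1 : p ∈ I (n + 1) := Ideal.subset_span ⟨n + 1, le_rfl, hp, hv⟩
    rwa [← h₀ (n + 1) (by omega), h₀ n hn] at h1
  suffices h : ∀ p ∈ I n, ev (MvPolynomial.homogeneousComponent (n + 1) p) ∈
      Submodule.span A (xs : Set V) * K n by
    have := h p hpI
    rwa [MvPolynomial.homogeneousComponent_of_mem hp, if_pos rfl] at this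
  intro p hp
  refine Submodule.span_induction (p := fun p _ => ∀ c : MvPolynomial xs A,
    ev (MvPolynomial.homogeneousComponent (n + 1) (c * p)) ∈
      Submodule.span A (xs : Set V) * K n) ?_ ?_ ?_ ?_ hp |> fun h => by simpa using h 1
  · rintro g ⟨j, hj, hg, hgK⟩ c
    induction c using MvPolynomial.induction_on' with
    | add p q hp hq =>
      rw [add_mul, map_add, map_add]
      exact add_mem hp hq
    | monomial s a =>
      have hh : (MvPolynomial.monomial s a * g).IsHomogeneous (s.degree + j) :=
        (MvPolynomial.isHomogeneous_monomial a rfl).mul hg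
      rw [MvPolynomial.homogeneousComponent_of_mem hh]
      split_ifs with hdeg
      · have hs : s ≠ 0 := by
          rintro rfl
          simp at hdeg
          omega
        obtain ⟨i, hi⟩ := Finsupp.ne_iff.mp hs
        -- split off one variable from the monomial
        obtain ⟨t, rfl⟩ : ∃ t, s = Finsupp.single i 1 + t :=
          ⟨s - Finsupp.single i 1, (add_tsub_cancel_of_le (by
            rw [Finsupp.single_le_iff]
            exact Nat.one_le_iff_ne_zero.mpr hi)).symm⟩
        have h1 := hmon t a j g hgK
        have h2 : j + t.degree = n := by
          rw [map_add, Finsupp.degree_single] at hdeg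
          omega
        rw [h2] at h1
        have h3 : MvPolynomial.monomial (Finsupp.single i 1 + t) a =
            MvPolynomial.X i * MvPolynomial.monomial t a := by
          rw [MvPolynomial.X, MvPolynomial.monomial_mul, one_mul]
        rw [h3, mul_assoc, map_mul]
        refine Submodule.mul_mem_mul (Submodule.subset_span ?_) h1
        simp [ev]
      · simp
  · intro c
    simp
  · intro x y _ _ hx hy c
    rw [mul_add, map_add, map_add]
    exact add_mem (hx c) (hy c)
  · intro b x _ hx c
    rw [smul_eq_mul, ← mul_assoc]
    exact hx _

end Hilbert

/-! ### Colengths of powers -/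

section CoeffSubmodule

variable {A S : Type*} [CommRing A] [CommRing S] [Algebra A S]

/-- The polynomials over `S` whose `i`-th coefficient lies in `T i`. -/
def coeffSubmodule (T : ℕ → Submodule A S) : Submodule A (Polynomial S) where
  carrier := {p | ∀ i, p.coeff i ∈ T i}
  add_mem' hp hq i := by
    rw [Polynomial.coeff_add]
    exact add_mem (hp i) (hq i)
  zero_mem' i := by simp
  smul_mem' c p hp i := by
    rw [Polynomial.coeff_smul]
    exact (T i).smul_mem c (hp i)

theorem coeffSubmodule_mono {T T' : ℕ → Submodule A S} (h : ∀ i, T i ≤ T' i) :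
    coeffSubmodule T ≤ coeffSubmodule T' := fun _ hp i => h i (hp i)

theorem monomial_mem_coeffSubmodule {T : ℕ → Submodule A S} {i : ℕ} {a : S} (ha : a ∈ T i) :
    Polynomial.monomial i a ∈ coeffSubmodule T := by
  intro j
  rw [Polynomial.coeff_monomial]
  split_ifs with h
  · exact h ▸ ha
  · exact zero_mem _

theorem relLength_coeffSubmodule (n : ℕ) : ∀ T' T : ℕ → Submodule A S, (∀ i, T' i ≤ T i) →
    (∀ i, n ≤ i → T' i = T i) → relLength (coeffSubmodule T') (coeffSubmodule T) =
      ∑ i ∈ Finset.range n, relLength (T' i) (T i) := by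
  induction n with
  | zero =>
    intro T' T _ h
    rw [show T' = T from funext fun i => h i (Nat.zero_le i), relLength_self, Finset.range_zero,
      Finset.sum_empty]
  | succ n ih =>
    intro T' T hle heq
    let U : ℕ → Submodule A S := Function.update T' n (T n)
    have hUn : U n = T n := Function.update_self ..
    have hU : ∀ i, i ≠ n → U i = T' i := fun i hi => Function.update_of_ne hi ..
    have h1 : ∀ i, T' i ≤ U i := fun i => by
      by_cases hi : i = n
      · subst hi
        rw [hUn]
        exact hle i
      · rw [hU i hi]
    have h2 : ∀ i, U i ≤ T i := fun i => by
      by_cases hi : i = n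
      · subst hi
        rw [hUn]
      · rw [hU i hi]
        exact hle i
    rw [← relLength_add (coeffSubmodule_mono h1) (coeffSubmodule_mono h2),
      ih U T h2 fun i hi => ?_, Finset.sum_range_succ, add_comm]
    · congr 1
      · exact Finset.sum_congr rfl fun i hi => by rw [hU i (Finset.mem_range.mp hi).ne]
      · let f : Polynomial S →ₗ[A] S := (Polynomial.lcoeff S n).restrictScalars A
        have e1 : coeffSubmodule T' = coeffSubmodule U ⊓ (T' n).comap f := by
          ext p
          constructor
          · exact fun hp => ⟨coeffSubmodule_mono h1 hp, hp n⟩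
          · rintro ⟨hp, hpn⟩ i
            by_cases hi : i = n
            · subst hi
              exact hpn
            · exact hU i hi ▸ hp i
        have e2 : T' n ⊔ (coeffSubmodule U).map f = T n := by
          apply le_antisymm
          · refine sup_le (hle n) ?_
            rintro _ ⟨p, hp, rfl⟩
            exact hUn ▸ hp n
          · intro a ha
            refine Submodule.mem_sup_right ⟨Polynomial.monomial n a,
              monomial_mem_coeffSubmodule (hUn.symm ▸ ha), ?_⟩
            simp [f]
        rw [e1, relLength_inf_comap, e2]
    · by_cases hi' : i = n
      · subst hi'
        exact hUn
      · rw [hU i hi', heq i (by omega)]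

end CoeffSubmodule

section Powers

variable {A S : Type*} [CommRing A] [CommRing S] [Algebra A S]

/-- For finitely generated modules `N ≤ H` of elements of degree one in a commutative algebra, such
that every `H ^ n / N ^ n` has finite length, this length is a polynomial in `n` for large `n`.
It is the sum of the lengths of the subquotients `N ^ i H ^ (n - i) / N ^ (i + 1) H ^ (n - i - 1)`
for `i < n`, and these form the degree `n` part of a graded module in the variables `H` and `N u`,
where the auxiliary polynomial variable `u` records the index `i`. -/
theorem eventuallyPolynomial_relLength_pow [IsNoetherianRing A] {N H : Submodule A S} (hNH : N ≤ H)
    (hN : N.FG) (hH : H.FG) (hfin : ∀ n, relLength (N ^ n) (H ^ n) ≠ ⊤) :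
    EventuallyPolynomial (fun n => ((relLength (N ^ n) (H ^ n)).toNat : ℚ)) := by
  classical
  let mon : ℕ → S →ₗ[A] Polynomial S := fun i => (Polynomial.monomial i).restrictScalars A
  obtain ⟨ns, hns⟩ := hN
  obtain ⟨hs, hhs⟩ := hH
  let xs : Finset (Polynomial S) := hs.image (mon 0) ∪ ns.image (mon 1)
  have hX : Submodule.span A (xs : Set (Polynomial S)) = H.map (mon 0) ⊔ N.map (mon 1) := by
    rw [Finset.coe_union, Finset.coe_image, Finset.coe_image, Submodule.span_union,
      ← Submodule.map_span, ← Submodule.map_span, hns, hhs]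
  let T : ℕ → ℕ → Submodule A S := fun n i => if i < n then N ^ i * H ^ (n - i) else ⊥
  let T' : ℕ → ℕ → Submodule A S := fun n i =>
    if i < n then N ^ (i + 1) * H ^ (n - (i + 1)) else ⊥
  have hW : ∀ n, ∀ i < n, N ^ (i + 1) * H ^ (n - (i + 1)) ≤ N ^ i * H ^ (n - i) := by
    intro n i hi
    rw [show n - i = n - (i + 1) + 1 by omega, pow_succ N, pow_succ' H, mul_assoc]
    exact mul_le_mul' le_rfl (mul_le_mul' hNH le_rfl)
  have hT : ∀ n i, T' n i ≤ T n i := fun n i => by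
    simp only [T, T']
    split_ifs with h
    · exact hW n i h
    · exact le_rfl
  have hclosed : ∀ U U' : ℕ → Submodule A S, (∀ i, H * U i ≤ U' i) →
      (∀ i, N * U i ≤ U' (i + 1)) →
      Submodule.span A (xs : Set (Polynomial S)) * coeffSubmodule U ≤ coeffSubmodule U' := by
    intro U U' h1 h2
    rw [hX, Submodule.sup_mul, sup_le_iff]
    constructor
    · refine Submodule.mul_le.mpr ?_
      rintro _ ⟨a, ha, rfl⟩ p hp i
      change (Polynomial.C a * p).coeff i ∈ _
      rw [Polynomial.coeff_C_mul]
      exact h1 i (Submodule.mul_mem_mul ha (hp i))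
    · refine Submodule.mul_le.mpr ?_
      rintro _ ⟨a, ha, rfl⟩ p hp i
      change (Polynomial.monomial 1 a * p).coeff i ∈ _
      rw [← Polynomial.C_mul_X_eq_monomial, mul_assoc, Polynomial.coeff_C_mul]
      cases i with
      | zero => simp
      | succ i =>
        rw [Polynomial.coeff_X_mul]
        exact h2 i (Submodule.mul_mem_mul ha (hp i))
  have hlen : ∀ n, relLength (coeffSubmodule (T' n)) (coeffSubmodule (T n)) =
      relLength (N ^ n) (H ^ n) := by
    intro n
    rw [relLength_coeffSubmodule n _ _ (hT n) fun i hi => by simp [T, T', hi.not_gt]]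
    have := sum_relLength (fun i => N ^ i * H ^ (n - i)) n (hW n)
    simp only [Nat.sub_self, pow_zero, mul_one, one_mul, Nat.sub_zero] at this
    rw [← this]
    refine Finset.sum_congr rfl fun i hi => ?_
    simp [T, T', Finset.mem_range.mp hi]
  have hpow : ∀ (e : ℕ) (P : Submodule A S), P.map (mon e) ≤ Submodule.span A (xs : Set _) →
      ∀ i, ∀ a ∈ P ^ i, Polynomial.monomial (i * e) a ∈
        Submodule.span A (xs : Set (Polynomial S)) ^ i := by
    intro e P hP i
    induction i with
    | zero =>
      intro a ha
      rw [pow_zero] at ha ⊢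
      obtain ⟨c, rfl⟩ := Submodule.mem_one.mp ha
      exact Submodule.mem_one.mpr ⟨c, by simp [Polynomial.algebraMap_apply]⟩
    | succ i ih =>
      intro a ha
      rw [pow_succ] at ha ⊢
      refine Submodule.mul_induction_on ha (fun b hb c hc => ?_) (fun b c hb hc => ?_)
      · rw [add_mul, one_mul, ← Polynomial.monomial_mul_monomial]
        exact Submodule.mul_mem_mul (ih b hb) (hP ⟨c, hc, rfl⟩)
      · rw [map_add]
        exact add_mem hb hc
  have key := eventuallyPolynomial_relLength xs (fun n => coeffSubmodule (T' n))
    (fun n => coeffSubmodule (T n)) (fun n => coeffSubmodule_mono (hT n))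
    (fun n => hclosed _ _ (fun i => ?_) (fun i => ?_))
    (fun n => hclosed _ _ (fun i => ?_) (fun i => ?_))
    (fun n => by rw [hlen]; exact hfin n)
    (eventuallyGenerated_of_le_pow xs _ _ fun n p hp => ?_)
  · simpa only [hlen] using key
  · simp only [T']
    split_ifs with h1 h2
    · rw [mul_left_comm, show n + 1 - (i + 1) = n - (i + 1) + 1 by omega, pow_succ' H]
    · omega
    · simp
    · simp
  · simp only [T']
    split_ifs with h1 h2
    · rw [← mul_assoc, ← pow_succ', show n + 1 - (i + 1 + 1) = n - (i + 1) by omega]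
    · omega
    · simp
    · simp
  · simp only [T]
    split_ifs with h1 h2
    · rw [mul_left_comm, show n + 1 - i = n - i + 1 by omega, pow_succ' H]
    · omega
    · simp
    · simp
  · simp only [T]
    split_ifs with h1 h2
    · rw [← mul_assoc, ← pow_succ', show n + 1 - (i + 1) = n - i by omega]
    · omega
    · simp
    · simp
  · rw [p.as_sum_support]
    refine Submodule.sum_mem _ fun i _ => ?_
    have hi := hp i
    simp only [T] at hi
    split_ifs at hi with h
    · rw [show (n : ℕ) = i + (n - i) by omega, pow_add]
      refine Submodule.mul_induction_on hi (fun b hb c hc => ?_) (fun b c hb hc => ?_)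
      · have h1 := hpow 1 N (hX ▸ le_sup_right) i b hb
        have h2 := hpow 0 H (hX ▸ le_sup_left) (n - i) c hc
        have h3 := Submodule.mul_mem_mul h1 h2
        rwa [Polynomial.monomial_mul_monomial, mul_one, mul_zero, add_zero] at h3
      · rw [map_add]
        exact add_mem hb hc
    · rw [(Submodule.mem_bot A).mp hi, map_zero]
      exact zero_mem _

end Powers

/-! ### Leading coefficients of eventually polynomial sequences -/

/-- An eventually polynomial sequence of size `O(n ^ D)` has a leading coefficient in degree `D`. -/
theorem EventuallyPolynomial.exists_tendsto {f : ℕ → ℚ} (hf : EventuallyPolynomial f)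
    (h0 : ∀ n, 0 ≤ f n) {C D : ℕ} (hC : ∀ n, 1 ≤ n → f n ≤ C * (n : ℚ) ^ D) :
    ∃ b : ℝ, 0 ≤ b ∧ Tendsto (fun n : ℕ => (f n : ℝ) / (n : ℝ) ^ D) atTop (𝓝 b) := by
  obtain ⟨p, hp⟩ := hf
  let P : Polynomial ℝ := p.map (algebraMap ℚ ℝ)
  have hP : ∀ᶠ n : ℕ in atTop, (f n : ℝ) / (n : ℝ) ^ D =
      P.eval (n : ℝ) / (Polynomial.X ^ D : Polynomial ℝ).eval (n : ℝ) := by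
    filter_upwards [hp] with n hn
    rw [hn, Polynomial.eval_pow, Polynomial.eval_X]
    congr 1
    have := Polynomial.eval_map_algebraMap p (n : ℝ)
    rw [this, ← eq_ratCast (algebraMap ℚ ℝ), ← Polynomial.aeval_algebraMap_apply_eq_algebraMap_eval]
    simp
  have hbound : ∀ᶠ n : ℕ in atTop, (f n : ℝ) / (n : ℝ) ^ D ≤ C := by
    filter_upwards [eventually_ge_atTop 1] with n hn
    have hn' : (0 : ℝ) < (n : ℝ) ^ D := by positivity
    rw [div_le_iff₀ hn']
    exact_mod_cast hC n hn
  have hnonneg : ∀ n : ℕ, 0 ≤ (f n : ℝ) / (n : ℝ) ^ D := fun n =>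
    div_nonneg (by exact_mod_cast h0 n) (by positivity)
  have hdeg : P.degree ≤ (Polynomial.X ^ D : Polynomial ℝ).degree := by
    by_contra! hlt
    have h1 := (Polynomial.abs_div_tendsto_atTop_atTop_of_degree_gt P _ hlt
      (pow_ne_zero D Polynomial.X_ne_zero)).comp tendsto_natCast_atTop_atTop
    obtain ⟨n, hn1, hn2, hn3⟩ := ((h1.eventually_gt_atTop (C : ℝ)).and (hP.and hbound)).exists
    simp only [Function.comp_apply] at hn1
    rw [← hn2, abs_of_nonneg (hnonneg n)] at hn1
    exact hn1.not_ge hn3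
  have hlim : ∃ b : ℝ, Tendsto (fun n : ℕ => (f n : ℝ) / (n : ℝ) ^ D) atTop (𝓝 b) := by
    rcases hdeg.lt_or_eq with h | h
    · exact ⟨0, ((Polynomial.div_tendsto_atTop_zero_of_degree_lt P _ h).comp
        tendsto_natCast_atTop_atTop).congr' (hP.mono fun n hn => hn.symm)⟩
    · exact ⟨_, ((Polynomial.div_tendsto_atTop_leadingCoeff_div_of_degree_eq P _ h).comp
        tendsto_natCast_atTop_atTop).congr' (hP.mono fun n hn => hn.symm)⟩
  obtain ⟨b, hb⟩ := hlim
  exact ⟨b, ge_of_tendsto' hb hnonneg, hb⟩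

theorem exists_tendsto_of_eventuallyPolynomial {f : ℕ → ℕ∞}
    (hf : EventuallyPolynomial (fun n => ((f n).toNat : ℚ))) (hfin : ∀ n, f n ≠ ⊤) {C D : ℕ}
    (hC : ∀ n, 1 ≤ n → f n ≤ C * (n : ℕ∞) ^ D) (c : ℕ) :
    ∃ b : ℝ≥0, Tendsto (fun n : ℕ => (c : ℝ≥0∞) * (f n : ℝ≥0∞) / (n : ℝ≥0∞) ^ D) atTop
      (𝓝 (b : ℝ≥0∞)) := by
  obtain ⟨b, hb0, hb⟩ := hf.exists_tendsto (C := C) (D := D) (fun n => by positivity) (by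
    intro n hn
    have h := hC n hn
    rw [← ENat.natCast_toNat (hfin n)] at h
    exact_mod_cast h)
  refine ⟨(c * b).toNNReal, ?_⟩
  have h1 := ENNReal.tendsto_ofReal (hb.const_mul (c : ℝ))
  refine h1.congr' ?_
  filter_upwards [eventually_ge_atTop 1] with n hn
  have hn' : (0 : ℝ) < (n : ℝ) ^ D := by positivity
  rw [← mul_div_assoc, ENNReal.ofReal_div_of_pos hn', ENNReal.ofReal_mul (by positivity),
    ENNReal.ofReal_natCast, ENNReal.ofReal_pow (by positivity), ENNReal.ofReal_natCast]
  congr 2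
  rw [Rat.cast_natCast, ENNReal.ofReal_natCast]
  conv_rhs => rw [← ENat.natCast_toNat (hfin n)]
  simp

/-! ### Upper bounds for colengths of powers -/

theorem relLength_smul_span_le {A M : Type*} [CommRing A] [AddCommGroup M] [Module A M]
    (I : Ideal A) (T : Finset M) :
    relLength (I • Submodule.span A (T : Set M)) (Submodule.span A (T : Set M)) ≤
      T.card * Module.length A (A ⧸ I) := by
  classical
  have h1 : relLength (Submodule.pi Set.univ fun _ : T => I) ⊤ =
      T.card * Module.length A (A ⧸ I) := by
    rw [relLength_top, (Submodule.quotientPi fun _ : T => I).length_eq, Module.length_pi,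
      ENat.card_eq_coe_fintype_card, Fintype.card_coe]
  rw [← h1]
  refine relLength_le_of_map (Fintype.linearCombination A (fun x : T => (x : M))) ?_ ?_
  · rintro _ ⟨c, hc, rfl⟩
    rw [Fintype.linearCombination_apply]
    exact Submodule.sum_mem _ fun x _ =>
      Submodule.smul_mem_smul (hc x trivial) (Submodule.subset_span x.2)
  · rw [← LinearMap.range_eq_map, Fintype.range_linearCombination]
    simp

/-- The `n`-th power of a module with `r + 1` generators is spanned by at most `(n + 1) ^ r`
elements, the monomials of degree `n` in the generators. -/
theorem exists_span_eq_span_range_pow {A S : Type*} [CommRing A] [CommRing S] [Algebra A S]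
    (r : ℕ) : ∀ (v : Fin (r + 1) → S) (n : ℕ), ∃ T : Finset S, T.card ≤ (n + 1) ^ r ∧
      Submodule.span A (T : Set S) = Submodule.span A (Set.range v) ^ n := by
  classical
  induction r with
  | zero =>
    intro v n
    refine ⟨{v 0 ^ n}, by simp, ?_⟩
    have : Set.range v = {v 0} := by
      ext x
      simp [Fin.exists_fin_one, eq_comm]
    rw [this, Submodule.span_pow, Set.singleton_pow, Finset.coe_singleton]
  | succ r ih =>
    intro v n
    have hr : Set.range v = insert (v 0) (Set.range (Fin.tail v)) := by
      conv_lhs => rw [← Fin.cons_self_tail v]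
      rw [Fin.range_cons]
    rw [hr, Submodule.span_insert]
    set e := Submodule.span A {v 0} with he
    set H' := Submodule.span A (Set.range (Fin.tail v)) with hH'
    induction n with
    | zero => exact ⟨{1}, by simp, by simp [Submodule.one_eq_span]⟩
    | succ n ihn =>
      obtain ⟨T₁, hc₁, hs₁⟩ := ih (Fin.tail v) (n + 1)
      obtain ⟨T₂, hc₂, hs₂⟩ := ihn
      refine ⟨T₁ ∪ T₂.image (v 0 * ·), ?_, ?_⟩
      · calc (T₁ ∪ T₂.image (v 0 * ·)).card ≤ (n + 1 + 1) ^ r + (n + 1) ^ (r + 1) :=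
              (Finset.card_union_le _ _).trans
                (add_le_add hc₁ (Finset.card_image_le.trans hc₂))
          _ ≤ (n + 1 + 1) ^ r + (n + 1) * (n + 1 + 1) ^ r := by
              rw [pow_succ' (n + 1)]
              gcongr
              omega
          _ = (n + 1 + 1) ^ (r + 1) := by ring
      · have h1 : Submodule.span A ((T₁ ∪ T₂.image (v 0 * ·) : Finset S) : Set S) =
            H' ^ (n + 1) ⊔ e * (e ⊔ H') ^ n := by
          rw [Finset.coe_union, Submodule.span_union, hs₁, Finset.coe_image, ← hs₂, he,
            Submodule.span_mul_span, Set.singleton_mul]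
        have h2 : ∀ n, H' * (e ⊔ H') ^ n ≤ H' ^ (n + 1) ⊔ e * (e ⊔ H') ^ n := by
          intro n
          induction n with
          | zero => simp
          | succ n ih =>
            rw [pow_succ' (e ⊔ H'), mul_left_comm, Submodule.sup_mul]
            refine sup_le ?_ ((mul_le_mul' le_rfl ih).trans ?_)
            · refine le_sup_of_le_right (mul_le_mul' le_rfl ?_)
              exact mul_le_mul' le_sup_right le_rfl
            · rw [Submodule.mul_sup, ← pow_succ', mul_left_comm]
              refine sup_le_sup le_rfl (mul_le_mul' le_rfl ?_)
              exact mul_le_mul' le_sup_right le_rfl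
        rw [h1]
        apply le_antisymm
        · refine sup_le (pow_le_pow_left' le_sup_right _) ?_
          rw [pow_succ']
          exact mul_le_mul' le_sup_left le_rfl
        · rw [pow_succ', Submodule.sup_mul]
          exact sup_le le_sup_right (h2 n)

/-- Replacing one generator `y` by `y ^ n` multiplies the colength by at most `n`. -/
theorem relLength_sup_span_pow_le {A : Type*} [CommRing A] (J : Ideal A) (y : A) (n : ℕ) :
    relLength (J ⊔ Ideal.span {y ^ n}) ⊤ ≤ n * relLength (J ⊔ Ideal.span {y}) ⊤ := by
  induction n with
  | zero => simp [relLength_self]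
  | succ n ih =>
    have h1 : J ⊔ Ideal.span {y ^ (n + 1)} ≤ J ⊔ Ideal.span {y} :=
      sup_le_sup_left (Ideal.span_singleton_le_span_singleton.mpr (dvd_pow_self y n.succ_ne_zero)) J
    rw [← relLength_add h1 le_top]
    push_cast
    rw [add_mul, one_mul]
    refine add_le_add (le_trans ?_ ih) le_rfl
    refine relLength_le_of_map (LinearMap.mulLeft A y) ?_ ?_
    · rw [Submodule.map_sup]
      refine sup_le_sup ?_ ?_
      · rintro _ ⟨x, hx, rfl⟩
        exact J.mul_mem_left y hx
      · rw [Submodule.map_le_iff_le_comap, Ideal.span_singleton_le_iff_mem]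
        exact Ideal.mem_span_singleton.mpr (by simp [pow_succ'])
    · refine sup_le (le_sup_left.trans le_sup_left) ?_
      rw [Ideal.span_singleton_le_iff_mem]
      exact Ideal.mem_sup_right ⟨1, trivial, by simp⟩

theorem relLength_sup_span_image_pow_le {A : Type*} [CommRing A] (s : Finset A) (n : ℕ) :
    ∀ J : Ideal A,
    relLength (J ⊔ Ideal.span ((· ^ n) '' (s : Set A))) ⊤ ≤
      (n : ℕ∞) ^ s.card * relLength (J ⊔ Ideal.span (s : Set A)) ⊤ := by
  classical
  induction s using Finset.induction_on with
  | empty => simp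
  | insert y s hy ih =>
    intro J
    have h1 := ih (J ⊔ Ideal.span {y ^ n})
    have h2 := relLength_sup_span_pow_le (J ⊔ Ideal.span (s : Set A)) y n
    rw [Finset.coe_insert, Set.image_insert_eq, Ideal.span_insert, Ideal.span_insert,
      Finset.card_insert_of_notMem hy, ← sup_assoc, ← sup_assoc, pow_succ, mul_assoc]
    rw [sup_right_comm, sup_right_comm J (Ideal.span (s : Set A))] at *
    exact h1.trans (mul_le_mul' le_rfl h2)

section PowerColength

variable {A : Type*} [CommRing A] [IsNoetherianRing A]

theorem length_quotient_maximal_pow_ne_top (M : Ideal A) [M.IsMaximal] (n : ℕ) :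
    Module.length A (A ⧸ M ^ n) ≠ ⊤ := by
  rw [← relLength_top]
  induction n with
  | zero => simp [Ideal.one_eq_top, relLength_self]
  | succ n ih =>
    rw [← relLength_add (Ideal.pow_le_pow_right (Nat.le_succ n)) le_top]
    refine WithTop.add_ne_top.mpr ⟨?_, ih⟩
    obtain ⟨T, hT⟩ := (isNoetherianRing_iff_ideal_fg A).mp inferInstance (M ^ n)
    have h1 := relLength_smul_span_le M T
    have h2 : Submodule.span A (T : Set A) = M ^ n := hT
    have h3 : Module.length A (A ⧸ M) = 1 := Module.length_eq_one_iff.mpr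
      (isSimpleModule_iff_isCoatom.mpr (Ideal.isMaximal_def.mp inferInstance))
    rw [h2, h3, mul_one, smul_eq_mul, ← pow_succ'] at h1
    exact ne_top_of_le_ne_top (ENat.natCast_ne_top _) h1

/-- If the maximal ideal `M` is minimal over `q`, then `q` contains a power of `M` up to arbitrarily
high powers of `M`. -/
theorem exists_pow_le_sup_pow {M q : Ideal A} [M.IsMaximal] (h : M ∈ q.minimalPrimes) :
    ∃ k, ∀ n, M ^ k ≤ q ⊔ M ^ n := by
  have hfin : (q.minimalPrimes \ {M}).Finite :=
    (Ideal.finite_minimalPrimes_of_isNoetherianRing A q).subset Set.sdiff_subset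
  -- an element outside `M` that lies in all other minimal primes of `q`
  have hJ : ¬ hfin.toFinset.inf id ≤ M := by
    rw [Ideal.IsPrime.inf_le' (Ideal.IsMaximal.isPrime inferInstance)]
    rintro ⟨P, hP, hPM⟩
    rw [Set.Finite.mem_toFinset] at hP
    exact hP.2 (le_antisymm hPM (h.2 hP.1.1 hPM))
  obtain ⟨g, hg, hgM⟩ := Set.not_subset.mp hJ
  have hrad : Ideal.span {g} * M ≤ q.radical := by
    rw [← Ideal.sInf_minimalPrimes]
    refine le_sInf fun P hP => ?_
    by_cases hPM : P = M
    · exact hPM ▸ Ideal.mul_le_right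
    · refine Ideal.mul_le_left.trans ((Ideal.span_singleton_le_iff_mem _).mpr ?_)
      exact (Finset.inf_le (f := id) (hfin.mem_toFinset.mpr ⟨hP, hPM⟩) :
        hfin.toFinset.inf id ≤ P) hg
  obtain ⟨k, hk⟩ := Ideal.exists_pow_le_of_le_radical_of_fg hrad (IsNoetherian.noetherian _)
  refine ⟨k, fun n => ?_⟩
  have hcop : Ideal.span {g} ⊔ M = ⊤ := by
    refine (Ideal.isMaximal_def.mp inferInstance).2 _ (lt_of_le_not_ge le_sup_right fun hle => ?_)
    exact hgM (hle (Ideal.mem_sup_left (Ideal.mem_span_singleton_self g)))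
  calc M ^ k = (Ideal.span {g} ^ k ⊔ M ^ n) * M ^ k := by
        rw [Ideal.pow_sup_pow_eq_top hcop, Ideal.top_mul]
    _ ≤ q ⊔ M ^ n := by
        rw [Ideal.sup_mul, ← mul_pow]
        exact sup_le_sup hk Ideal.mul_le_left

/-- The length of `A / M ^ n` is `O(n ^ s)`, where `s` is the height of the maximal ideal `M`:
`M` is minimal over an ideal `(y₁, …, y_s)`, and `A / M ^ n` is a quotient of
`A / ((y₁ ^ n, …, y_s ^ n) + M ^ n)`. -/
theorem exists_length_quotient_maximal_pow_le (M : Ideal A) [M.IsMaximal] {s : ℕ}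
    (hs : M.height = s) :
    ∃ C : ℕ, ∀ n : ℕ, Module.length A (A ⧸ M ^ n) ≤ C * (n : ℕ∞) ^ s := by
  obtain ⟨t, ht, hcard⟩ := M.exists_finset_card_eq_height_of_isNoetherianRing
  rw [hs, Nat.cast_inj] at hcard
  subst hcard
  obtain ⟨k, hk⟩ := exists_pow_le_sup_pow ht
  refine ⟨(Module.length A (A ⧸ M ^ k)).toNat, fun n => ?_⟩
  rw [ENat.natCast_toNat (length_quotient_maximal_pow_ne_top M k), ← relLength_top,
    ← relLength_top, mul_comm]
  have h1 : M ^ n ⊔ Ideal.span ((· ^ n) '' (t : Set A)) ≤ M ^ n := by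
    refine sup_le le_rfl (Ideal.span_le.mpr ?_)
    rintro _ ⟨y, hy, rfl⟩
    exact Ideal.pow_mem_pow (ht.1.2 (Ideal.subset_span hy)) n
  refine (relLength_anti_left h1 _).trans ((relLength_sup_span_image_pow_le t n _).trans ?_)
  refine mul_le_mul' le_rfl (relLength_anti_left ?_ _)
  rw [sup_comm]
  exact hk n

end PowerColength

/-! ### Growth and Krull dimension -/

section Growth

variable {A : Type*} [CommRing A]

/-- If passing from a prime to a strictly larger one lowers the growth function by one of its
differences, then along a chain of primes of length `s` the growth is at least that of `n ^ s`. -/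
theorem exists_pow_le_of_ltSeries (f : PrimeSpectrum A → ℕ → ℕ∞) (hmono : ∀ p, Monotone (f p))
    (hpos : ∀ p n, 1 ≤ n → 1 ≤ f p n)
    (hstep : ∀ p q, p < q → ∃ c, ∀ n, f q (n + c) + f p n ≤ f p (n + c)) (s : ℕ) :
    ∀ l : LTSeries (PrimeSpectrum A), l.length = s →
      ∃ K : ℕ, 1 ≤ K ∧ ∀ n : ℕ, 1 ≤ n → (n : ℕ∞) ^ s ≤ K * f l.head (K * n) := by
  induction s with
  | zero =>
    intro l _
    refine ⟨1, le_rfl, fun n hn => ?_⟩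
    rw [pow_zero, Nat.cast_one, one_mul]
    exact hpos _ _ (by omega)
  | succ s ih =>
    intro l hl
    have h0 : l.length ≠ 0 := by omega
    obtain ⟨K, hK1, hK⟩ := ih (l.tail h0) (by rw [RelSeries.tail_length]; omega)
    have hlt : l.head < (l.tail h0).head := by
      rw [RelSeries.head_tail]
      refine LTSeries.strictMono l (Fin.lt_def.mpr ?_)
      rw [Fin.val_zero, Fin.val_one', Nat.mod_eq_of_lt (by omega)]
      exact one_pos
    obtain ⟨c, hc⟩ := hstep _ _ hlt
    set p := l.head
    set q := (l.tail h0).head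
    refine ⟨K + c, by omega, fun n hn => ?_⟩
    have key : ∀ j : ℕ, (j : ℕ∞) * f q (K * n) ≤ f p (K * n + j * c) := by
      intro j
      induction j with
      | zero => simp
      | succ j ihj =>
        calc ((j + 1 : ℕ) : ℕ∞) * f q (K * n) = f q (K * n) + j * f q (K * n) := by
              rw [Nat.cast_succ, add_mul, one_mul, add_comm]
          _ ≤ f q (K * n + j * c + c) + f p (K * n + j * c) :=
              add_le_add (hmono q (by omega)) ihj
          _ ≤ f p (K * n + j * c + c) := hc _
          _ = f p (K * n + (j + 1) * c) := by
              rw [add_mul, one_mul, add_assoc]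
    calc (n : ℕ∞) ^ (s + 1) = n * (n : ℕ∞) ^ s := pow_succ' _ _
      _ ≤ n * (K * f q (K * n)) := mul_le_mul' le_rfl (hK n hn)
      _ = K * (n * f q (K * n)) := mul_left_comm _ _ _
      _ ≤ K * f p (K * n + n * c) := mul_le_mul' le_rfl (key n)
      _ ≤ ((K + c : ℕ) : ℕ∞) * f p ((K + c) * n) := by
          refine mul_le_mul' (by exact_mod_cast Nat.le_add_right K c) (hmono p ?_)
          rw [add_mul, mul_comm n c]

theorem ringKrullDim_le_of_growth (f : PrimeSpectrum A → ℕ → ℕ∞) (hmono : ∀ p, Monotone (f p))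
    (hpos : ∀ p n, 1 ≤ n → 1 ≤ f p n)
    (hstep : ∀ p q, p < q → ∃ c, ∀ n, f q (n + c) + f p n ≤ f p (n + c)) {C e : ℕ}
    (hC : ∀ p n, f p n ≤ C * (n : ℕ∞) ^ e) : ringKrullDim A ≤ e := by
  refine iSup_le fun l => ?_
  obtain ⟨K, hK1, hK⟩ := exists_pow_le_of_ltSeries f hmono hpos hstep _ l rfl
  by_contra! hlt
  have hlt' : e + 1 ≤ l.length := by exact_mod_cast hlt
  set n := K * C * K ^ e + 1 with hn
  have h1 := (hK n (by omega)).trans (mul_le_mul' le_rfl (hC _ _))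
  have h2 : n ^ l.length ≤ K * (C * (K * n) ^ e) := by exact_mod_cast h1
  have h3 : n ^ (e + 1) ≤ K * (C * (K * n) ^ e) :=
    (Nat.pow_le_pow_right (by omega) hlt').trans h2
  have h4 : n * n ^ e ≤ (K * C * K ^ e) * n ^ e := by
    calc n * n ^ e = n ^ (e + 1) := (pow_succ' _ _).symm
      _ ≤ _ := h3
      _ = _ := by rw [mul_pow, mul_assoc, mul_assoc]
  have h5 := Nat.le_of_mul_le_mul_right h4 (by positivity)
  omega

/-- The dimension of a Noetherian local ring is bounded by the order of growth of the lengths of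
`R / m ^ n`. For primes `p < q` and `x ∈ q \ p`, the Artin-Rees lemma bounds
`(p + m ^ (n + c)) : x` by `p + m ^ n`. -/
theorem ringKrullDim_le_of_length_quotient_pow_le {R : Type*} [CommRing R] [IsLocalRing R]
    [IsNoetherianRing R] {C e : ℕ}
    (hC : ∀ n : ℕ, Module.length R (R ⧸ IsLocalRing.maximalIdeal R ^ n) ≤ C * (n : ℕ∞) ^ e) :
    ringKrullDim R ≤ e := by
  set m := IsLocalRing.maximalIdeal R with hm
  refine ringKrullDim_le_of_growth
    (fun p n => relLength (p.asIdeal ⊔ m ^ n) ⊤) ?_ ?_ ?_ (C := C) ?_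
  · intro p a b hab
    exact relLength_anti_left (sup_le_sup_left (Ideal.pow_le_pow_right hab) _) _
  · intro p n hn
    rw [relLength_top]
    have hne : p.asIdeal ⊔ m ^ n ≠ ⊤ := by
      refine ne_top_of_le_ne_top (Ideal.IsMaximal.ne_top (I := m) inferInstance) (sup_le ?_ ?_)
      · exact IsLocalRing.le_maximalIdeal p.isPrime.ne_top
      · exact Ideal.pow_le_self (by omega)
    have : Nontrivial (R ⧸ (p.asIdeal ⊔ m ^ n)) := Ideal.Quotient.nontrivial_iff.mpr hne
    exact Order.one_le_iff_ne_zero.mpr Module.length_pos.ne'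
  · intro p q hpq
    obtain ⟨x, hxq, hxp⟩ := Set.not_subset.mp (not_le_of_gt hpq : ¬ q.asIdeal ≤ p.asIdeal)
    obtain ⟨c, hc⟩ := Ideal.exists_pow_inf_eq_pow_smul m (p.asIdeal ⊔ Ideal.span {x})
    refine ⟨c, fun n => ?_⟩
    have h1 : p.asIdeal ⊔ m ^ (n + c) ≤ (p.asIdeal ⊔ m ^ (n + c)) ⊔ Ideal.span {x} := le_sup_left
    rw [← relLength_add h1 le_top, add_comm]
    refine add_le_add ?_ (relLength_anti_left ?_ _)
    · have h2 := relLength_inf_comap (LinearMap.mulLeft R x) ⊤ (p.asIdeal ⊔ m ^ (n + c))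
      have h3 : Submodule.map (LinearMap.mulLeft R x) ⊤ = Ideal.span {x} := by
        ext y
        simp [Ideal.mem_span_singleton, Dvd.dvd, eq_comm]
      rw [h3, top_inf_eq] at h2
      rw [← h2]
      refine relLength_anti_left ?_ _
      intro a ha
      obtain ⟨u, hu, y, hy, huy⟩ := Submodule.mem_sup.mp ha
      rw [LinearMap.mulLeft_apply] at huy
      have hyN : y ∈ p.asIdeal ⊔ Ideal.span {x} := by
        rw [show y = -u + x * a by linear_combination huy]
        exact add_mem (Ideal.mem_sup_left (neg_mem hu)) (Ideal.mem_sup_right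
          (Ideal.mul_mem_right a _ (Ideal.mem_span_singleton_self x)))
      have hy' : y ∈ m ^ n * (p.asIdeal ⊔ Ideal.span {x}) := by
        have h4 := hc (n + c) (by omega)
        have h5 : y ∈ m ^ (n + c) • (⊤ : Ideal R) ⊓ (p.asIdeal ⊔ Ideal.span {x}) :=
          ⟨by rwa [smul_eq_mul, Ideal.mul_top], hyN⟩
        rw [h4, Nat.add_sub_cancel, smul_eq_mul] at h5
        have h6 : m ^ n * (m ^ c • ⊤ ⊓ (p.asIdeal ⊔ Ideal.span {x})) ≤
            m ^ n * (p.asIdeal ⊔ Ideal.span {x}) := mul_le_mul' le_rfl inf_le_right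
        exact h6 h5
      rw [Ideal.mul_sup] at hy'
      obtain ⟨w, hw, z, hz, rfl⟩ := Submodule.mem_sup.mp hy'
      obtain ⟨b, hb, rfl⟩ := Ideal.mem_mul_span_singleton.mp hz
      have h6 : x * (a - b) ∈ p.asIdeal := by
        rw [show x * (a - b) = u + w by linear_combination huy.symm]
        exact add_mem hu ((Ideal.mul_le_right : m ^ n * p.asIdeal ≤ p.asIdeal) hw)
      have h7 := (p.isPrime.mem_or_mem h6).resolve_left hxp
      rw [← sub_add_cancel a b]
      exact add_mem (Ideal.mem_sup_left h7) (Ideal.mem_sup_right hb)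
    · refine sup_le (sup_le (le_sup_of_le_left hpq.le) le_sup_right)
        ((Ideal.span_singleton_le_iff_mem _).mpr (Ideal.mem_sup_left hxq))
  · intro p n
    refine (relLength_anti_left (le_sup_right : m ^ n ≤ _) _).trans ?_
    rw [relLength_top]
    exact hC n

/-- The dimension of a commutative algebra with an exhaustive filtration `B` is bounded by the order
of growth of the lengths of `B n`. -/
theorem ringKrullDim_le_of_filtration {R : Type*} [CommRing R] [Algebra R A]
    (B : ℕ → Submodule R A) (hB : Monotone B) (h1 : 1 ∈ B 1) (hmul : ∀ i j, B i * B j ≤ B (i + j))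
    (hex : ∀ x, ∃ c, x ∈ B c) {C e : ℕ} (hC : ∀ n : ℕ, relLength ⊥ (B n) ≤ C * (n : ℕ∞) ^ e) :
    ringKrullDim A ≤ e := by
  refine ringKrullDim_le_of_growth
    (fun p n => relLength (p.asIdeal.restrictScalars R) (B n)) ?_ ?_ ?_ (C := C) ?_
  · intro p a b hab
    exact relLength_mono_right _ (hB hab)
  · intro p n hn
    refine Order.one_le_iff_ne_zero.mpr fun h0 => ?_
    have : Subsingleton _ := Module.length_eq_zero_iff.mp h0
    have h2 := (Submodule.Quotient.subsingleton_iff.mp this).ge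
      (x := (⟨1, hB hn h1⟩ : B n)) trivial
    exact (Ideal.ne_top_iff_one _).mp p.isPrime.ne_top h2
  · intro p q hpq
    obtain ⟨x, hxq, hxp⟩ := Set.not_subset.mp (not_le_of_gt hpq : ¬ q.asIdeal ≤ p.asIdeal)
    obtain ⟨c, hc⟩ := hex x
    refine ⟨c, fun n => ?_⟩
    let P := p.asIdeal.restrictScalars R
    let Q := q.asIdeal.restrictScalars R
    have hPQ : P ≤ Q := hpq.le
    change relLength Q (B (n + c)) + relLength P (B n) ≤ relLength P (B (n + c))
    rw [← relLength_sup P (B (n + c)), ← relLength_add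
      (le_inf hPQ le_sup_left : P ≤ Q ⊓ (P ⊔ B (n + c))) inf_le_right, add_comm]
    refine add_le_add ?_ ?_
    · have h2 := relLength_inf_comap (LinearMap.mulLeft R x) (B n) P
      have h3 : P.comap (LinearMap.mulLeft R x) = P := by
        ext y
        refine ⟨fun hy => (p.isPrime.mem_or_mem hy).resolve_left hxp, fun hy => ?_⟩
        exact p.asIdeal.mul_mem_left x hy
      rw [h3, relLength_inf] at h2
      rw [h2]
      refine relLength_mono_right _ (sup_le (le_inf hPQ le_sup_left) (le_inf ?_ ?_))
      · rintro _ ⟨y, _, rfl⟩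
        exact q.asIdeal.mul_mem_right y hxq
      · rintro _ ⟨y, hy, rfl⟩
        refine Submodule.mem_sup_right ?_
        rw [add_comm]
        exact hmul c n (Submodule.mul_mem_mul hc hy)
    · rw [inf_comm, relLength_inf]
      exact relLength_mono_right _ le_sup_right
  · intro p n
    exact (relLength_anti_left bot_le _).trans (hC n)

end Growth

/-! ### Existence of the multiplicities -/

section Existence

variable {A : Type*} [CommRing A]

theorem reesColength_eq_relLength {F : Type*} [AddCommGroup F] [Module A F] (E : Submodule A F)
    (n : ℕ) : reesColength E n = relLength (E.map (SymmetricAlgebra.ι A F) ^ n)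
      (LinearMap.range (SymmetricAlgebra.ι A F) ^ n) := by
  rw [← reesPart_eq_pow]
  rfl

theorem smul_pow_le {S : Type*} [CommRing S] [Algebra A S] (I : Ideal A) (k : ℕ)
    {N H : Submodule A S} (h : I ^ k • H ≤ N) (n : ℕ) : I ^ (k * n) • H ^ n ≤ N ^ n := by
  induction n with
  | zero => simp
  | succ n ih =>
    rw [Nat.mul_succ, pow_add, pow_succ, pow_succ, Submodule.smul_le]
    intro c hc x hx
    refine Submodule.mul_induction_on hc (fun a ha b hb => ?_) (fun a b ha hb => ?_)
    · refine Submodule.mul_induction_on hx (fun y hy z hz => ?_) (fun y z hy hz => ?_)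
      · rw [← smul_mul_smul_comm]
        exact Submodule.mul_mem_mul (ih (Submodule.smul_mem_smul ha hy))
          (h (Submodule.smul_mem_smul hb hz))
      · rw [smul_add]
        exact add_mem hy hz
    · rw [add_smul]
      exact add_mem ha hb

theorem reesColength_of_isEmpty (E : Submodule A (Fin 0 → A)) (n : ℕ) : reesColength E n = 0 := by
  rw [reesColength_eq_relLength, Subsingleton.elim E ⊤, ← LinearMap.range_eq_map, relLength_self]

/-- If `E` contains `I ^ k F` and the lengths of `A / I ^ n` are `O(n ^ d)`, then the lengths of
`F ^ n / E ^ n` are `O(n ^ (d + r - 1))`. -/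
theorem exists_reesColength_le {r : ℕ} (I : Ideal A) {k : ℕ} {E : Submodule A (Fin r → A)}
    (hE : I ^ k • ⊤ ≤ E) {C d : ℕ}
    (hC : ∀ n : ℕ, Module.length A (A ⧸ I ^ n) ≤ C * (n : ℕ∞) ^ d) :
    ∃ C' : ℕ, (∀ n : ℕ, reesColength E n ≤ (C' * (n + 1) ^ (d + r - 1) : ℕ)) ∧
      ∀ n : ℕ, 1 ≤ n → reesColength E n ≤ C' * (n : ℕ∞) ^ (d + r - 1) := by
  suffices h : ∃ C' : ℕ, ∀ n : ℕ, reesColength E n ≤ (C' * (n + 1) ^ (d + r - 1) : ℕ) by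
    obtain ⟨C', hC'⟩ := h
    refine ⟨C' * 2 ^ (d + r - 1), fun n => (hC' n).trans ?_, fun n hn => (hC' n).trans ?_⟩
    · exact_mod_cast Nat.mul_le_mul_right _ (Nat.le_mul_of_pos_right _ (by positivity))
    · have : C' * (n + 1) ^ (d + r - 1) ≤ C' * 2 ^ (d + r - 1) * n ^ (d + r - 1) := by
        rw [mul_assoc, ← mul_pow]
        gcongr
        omega
      exact_mod_cast this
  cases r with
  | zero => exact ⟨0, fun n => by simp [reesColength_of_isEmpty]⟩
  | succ r =>
    let ι := SymmetricAlgebra.ι A (Fin (r + 1) → A)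
    have hrange : LinearMap.range ι =
        Submodule.span A (Set.range fun i => ι (Pi.basisFun A (Fin (r + 1)) i)) := by
      rw [Set.range_comp' ι (Pi.basisFun A (Fin (r + 1))), Submodule.span_image,
        (Pi.basisFun A (Fin (r + 1))).span_eq, LinearMap.range_eq_map]
    have hIH : I ^ k • LinearMap.range ι ≤ E.map ι := by
      rw [LinearMap.range_eq_map, ← Submodule.map_smul'']
      exact Submodule.map_mono hE
    refine ⟨C * k ^ d, fun n => ?_⟩
    obtain ⟨T, hT, hspan⟩ := exists_span_eq_span_range_pow (A := A) r
      (fun i => ι (Pi.basisFun A (Fin (r + 1)) i)) n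
    rw [← hrange] at hspan
    rw [reesColength_eq_relLength]
    refine (relLength_anti_left (smul_pow_le I k hIH n) _).trans ?_
    rw [← hspan]
    refine (relLength_smul_span_le _ T).trans ((mul_le_mul' (Nat.cast_le.mpr hT) (hC _)).trans ?_)
    have : (n + 1) ^ r * (C * (k * n) ^ d) ≤ C * k ^ d * (n + 1) ^ (d + (r + 1) - 1) := by
      rw [show d + (r + 1) - 1 = d + r by omega, pow_add, mul_pow]
      calc (n + 1) ^ r * (C * (k ^ d * n ^ d)) ≤ (n + 1) ^ r * (C * (k ^ d * (n + 1) ^ d)) := by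
            gcongr
            omega
        _ = C * k ^ d * ((n + 1) ^ d * (n + 1) ^ r) := by ring
    exact_mod_cast this

variable [IsNoetherianRing A]

theorem exists_isBuchsbaumRimMultiplicity {r : ℕ} (I : Ideal A) {k : ℕ}
    {E : Submodule A (Fin r → A)} (hE : I ^ k • ⊤ ≤ E) {C d : ℕ} (hd : ringKrullDim A = d)
    (hC : ∀ n : ℕ, Module.length A (A ⧸ I ^ n) ≤ C * (n : ℕ∞) ^ d) :
    ∃ b : ℝ≥0, IsBuchsbaumRimMultiplicity E b := by
  obtain ⟨C', h1, h2⟩ := exists_reesColength_le I hE hC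
  have hfin : ∀ n, reesColength E n ≠ ⊤ := fun n =>
    ne_top_of_le_ne_top (ENat.natCast_ne_top _) (h1 n)
  have hpoly : EventuallyPolynomial (fun n => ((reesColength E n).toNat : ℚ)) := by
    simp only [reesColength_eq_relLength] at hfin ⊢
    refine eventuallyPolynomial_relLength_pow ?_ ?_ ?_ hfin
    · exact LinearMap.map_le_range
    · exact (IsNoetherian.noetherian E).map _
    · rw [LinearMap.range_eq_map]
      exact (IsNoetherian.noetherian ⊤).map _
  obtain ⟨b, hb⟩ := exists_tendsto_of_eventuallyPolynomial hpoly hfin h2 (d + r - 1)!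
  exact ⟨b, d, hd, hb⟩

theorem exists_isHilbertSamuelMultiplicity (I : Ideal A) {C d : ℕ} (hd : ringKrullDim A = d)
    (hC : ∀ n : ℕ, Module.length A (A ⧸ I ^ n) ≤ C * (n : ℕ∞) ^ d) :
    ∃ e : ℝ≥0, IsHilbertSamuelMultiplicity I e := by
  have hfin : ∀ n, Module.length A (A ⧸ I ^ n) ≠ ⊤ := fun n =>
    ne_top_of_le_ne_top (ENat.natCast_ne_top (C * n ^ d)) (by exact_mod_cast hC n)
  have hpoly : EventuallyPolynomial (fun n => ((Module.length A (A ⧸ I ^ n)).toNat : ℚ)) := by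
    have htop : ∀ n, (⊤ : Ideal A) ^ n = ⊤ := fun n => Ideal.top_pow A n
    have := eventuallyPolynomial_relLength_pow (A := A) (S := A) (N := I) (H := ⊤) le_top
      (IsNoetherian.noetherian _) (IsNoetherian.noetherian _) (fun n => by
        change relLength (I ^ n) ((⊤ : Ideal A) ^ n) ≠ ⊤
        rw [htop, relLength_top]
        exact hfin n)
    convert this using 5 with n
    change _ = relLength (I ^ n) ((⊤ : Ideal A) ^ n)
    rw [htop, relLength_top]
  obtain ⟨b, hb⟩ := exists_tendsto_of_eventuallyPolynomial hpoly hfin (fun n _ => hC n) d !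
  exact ⟨b, d, hd, hb⟩

end Existence

/-! ### The associated graded ring and the module of leading forms -/

open Polynomial in
/-- The kernel of `R[It] → gr_I(R)` consists of the `f` whose `j`-th coefficient lies in
`I ^ (j + 1)` for all `j`. -/
theorem coeff_mem_of_mk_eq_zero {R : Type*} [CommRing R] {I : Ideal R} {f : reesAlgebra I}
    (hf : AssocGraded.mk I f = 0) (j : ℕ) : (f : R[X]).coeff j ∈ I ^ (j + 1) := by
  have hf' : f ∈ I.map (algebraMap R (reesAlgebra I)) := Ideal.Quotient.eq_zero_iff_mem.mp hf
  refine Submodule.span_induction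
    (p := fun (f : reesAlgebra I) _ => ∀ j, (f : R[X]).coeff j ∈ I ^ (j + 1)) ?_ ?_ ?_ ?_ hf' j
  · rintro _ ⟨x, hx, rfl⟩ j
    change (C x).coeff j ∈ _
    rw [coeff_C]
    split_ifs with h
    · subst h
      simpa using hx
    · exact zero_mem _
  · simp
  · intro x y _ _ hx hy j
    simpa using add_mem (hx j) (hy j)
  · intro c x _ hx j
    rw [smul_eq_mul, MulMemClass.coe_mul, coeff_mul]
    refine Ideal.sum_mem _ ?_
    rintro ⟨k, l⟩ e
    rw [← Finset.HasAntidiagonal.mem_antidiagonal.mp e, add_assoc, pow_add]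
    exact Ideal.mul_mem_mul (c.2 k) (hx l)

instance {R : Type*} [CommRing R] [IsNoetherianRing R] (I : Ideal R) :
    IsNoetherianRing (AssocGraded I) :=
  inferInstanceAs (IsNoetherianRing (reesAlgebra I ⧸ I.map (algebraMap R (reesAlgebra I))))

theorem assocGraded_mk_surjective {R : Type*} [CommRing R] (I : Ideal R) :
    Function.Surjective (AssocGraded.mk I) :=
  Ideal.Quotient.mk_surjective

-- With the ring structure of `gr_I(R)` opaque, its additive group structure is found to be the same
-- whether it comes from the ring or from the semiring structure.
attribute [local irreducible] instCommRingAssocGraded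

section Graded

variable {R : Type*} [CommRing R] (I : Ideal R)

theorem algebraMap_eq_gradedClass (a : R) :
    algebraMap R (AssocGraded I) a = gradedClass I 0 ⟨a, by simp⟩ := by
  change AssocGraded.mk I (algebraMap R (reesAlgebra I) a) = AssocGraded.mk I _
  congr 1

theorem gradedClass_eq_zero_of_mem {i : ℕ} (a : ↥(I ^ i)) (ha : (a : R) ∈ I ^ (i + 1)) :
    gradedClass I i a = 0 := (gradedClass_eq_zero_iff I i a).mpr ha

/-- The elements of `gr_I(R)` of degree less than `n`. -/
noncomputable def gradedBelow (n : ℕ) : Submodule R (AssocGraded I) :=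
  ⨆ i, ⨆ _ : i < n, LinearMap.range (gradedClass I i)

theorem gradedClass_mem_gradedBelow {i n : ℕ} (h : i < n) (a : ↥(I ^ i)) :
    gradedClass I i a ∈ gradedBelow I n :=
  Submodule.mem_iSup_of_mem i (Submodule.mem_iSup_of_mem h ⟨a, rfl⟩)

theorem gradedBelow_le_iff {n : ℕ} {P : Submodule R (AssocGraded I)} :
    gradedBelow I n ≤ P ↔ ∀ i < n, ∀ a, gradedClass I i a ∈ P := by
  simp only [gradedBelow, iSup_le_iff, LinearMap.range_le_iff_comap, Submodule.eq_top_iff',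
    Submodule.mem_comap]

theorem gradedBelow_mono : Monotone (gradedBelow I) := fun _ _ h =>
  (gradedBelow_le_iff I).mpr fun _ hi a => gradedClass_mem_gradedBelow I (hi.trans_le h) a

theorem gradedBelow_zero : gradedBelow I 0 = ⊥ := by simp [gradedBelow]

theorem gradedBelow_succ (n : ℕ) :
    gradedBelow I (n + 1) = gradedBelow I n ⊔ LinearMap.range (gradedClass I n) := by
  apply le_antisymm
  · refine (gradedBelow_le_iff I).mpr fun i hi a => ?_
    rcases Nat.lt_succ_iff_lt_or_eq.mp hi with h | rfl
    · exact Submodule.mem_sup_left (gradedClass_mem_gradedBelow I h a)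
    · exact Submodule.mem_sup_right ⟨a, rfl⟩
  · refine sup_le (gradedBelow_mono I n.le_succ) ?_
    rintro _ ⟨a, rfl⟩
    exact gradedClass_mem_gradedBelow I n.lt_succ_self a

theorem gradedBelow_mul_le (i j : ℕ) :
    gradedBelow I i * gradedBelow I j ≤ gradedBelow I (i + j) := by
  have h : ∀ a : AssocGraded I, ∀ (P : Submodule R (AssocGraded I)) x,
      a * x ∈ P ↔ x ∈ P.comap (LinearMap.mulLeft R a) := fun _ _ _ => Iff.rfl
  have h' : ∀ a : AssocGraded I, ∀ (P : Submodule R (AssocGraded I)) x,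
      x * a ∈ P ↔ x ∈ P.comap (LinearMap.mulRight R a) := fun _ _ _ => Iff.rfl
  rw [Submodule.mul_le]
  intro x hx y hy
  rw [h']
  refine (gradedBelow_le_iff I).mpr (fun k hk a => ?_) hx
  rw [← h', h]
  refine (gradedBelow_le_iff I).mpr (fun l hl b => ?_) hy
  rw [← h, gradedClass_mul]
  exact gradedClass_mem_gradedBelow I (by omega) _

theorem exists_mem_gradedBelow (x : AssocGraded I) : ∃ c, x ∈ gradedBelow I c := by
  have hx : x ∈ ⨆ i, LinearMap.range (gradedClass I i) := by simp [iSup_range_gradedClass]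
  refine Submodule.iSup_induction _ (motive := fun x => ∃ c, x ∈ gradedBelow I c) hx ?_ ?_ ?_
  · rintro i _ ⟨a, rfl⟩
    exact ⟨i + 1, gradedClass_mem_gradedBelow I i.lt_succ_self a⟩
  · exact ⟨0, zero_mem _⟩
  · rintro x y ⟨c, hc⟩ ⟨c', hc'⟩
    exact ⟨max c c', add_mem (gradedBelow_mono I (le_max_left c c') hc)
      (gradedBelow_mono I (le_max_right c c') hc')⟩

theorem relLength_gradedBelow_le (n : ℕ) :
    relLength ⊥ (gradedBelow I n) ≤ Module.length R (R ⧸ I ^ n) := by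
  rw [← relLength_top]
  induction n with
  | zero => simp [gradedBelow_zero, relLength_self]
  | succ n ih =>
    rw [← relLength_add bot_le (gradedBelow_mono I n.le_succ),
      ← relLength_add (Ideal.pow_le_pow_right n.le_succ) (le_top : I ^ n ≤ ⊤), add_comm]
    refine add_le_add ?_ ih
    have h : relLength (I ^ (n + 1)) (I ^ n) =
        relLength ((I ^ (n + 1)).submoduleOf (I ^ n)) ⊤ := by
      rw [relLength_top]
      rfl
    rw [h, gradedBelow_succ, LinearMap.range_eq_map]
    refine relLength_le_of_map (gradedClass I n) ?_ le_rfl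
    rintro _ ⟨a, ha, rfl⟩
    rw [gradedClass_eq_zero_of_mem I a ha]
    exact zero_mem _

theorem gradedClass_mem_irrelevantIdeal_pow (i : ℕ) : ∀ (a : R) (ha : a ∈ I ^ i),
    gradedClass I i ⟨a, ha⟩ ∈ irrelevantIdeal I ^ i := by
  induction i with
  | zero => simp
  | succ i ih =>
    intro a ha
    have ha' : a ∈ I ^ i * I := by rwa [← pow_succ]
    have key : ∀ x ∈ I ^ i * I, ∃ h : x ∈ I ^ (i + 1),
        gradedClass I (i + 1) ⟨x, h⟩ ∈ irrelevantIdeal I ^ (i + 1) := by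
      intro x hx
      refine Submodule.mul_induction_on hx (fun b hb c hc => ?_) ?_
      · have hc' : c ∈ I ^ 1 := by rwa [pow_one]
        have h := gradedClass_mul I i 1 ⟨b, hb⟩ ⟨c, hc'⟩
        refine ⟨by rw [pow_succ]; exact Ideal.mul_mem_mul hb hc, ?_⟩
        rw [← h, pow_succ]
        exact Ideal.mul_mem_mul (ih b hb) (Ideal.subset_span ⟨1, le_rfl, _, rfl⟩)
      · rintro x y ⟨hx, hx'⟩ ⟨hy, hy'⟩
        refine ⟨add_mem hx hy, ?_⟩
        have := add_mem hx' hy'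
        rwa [← map_add] at this
    exact (key a ha').2

theorem gradedClass_mem_irrelevantIdeal_pow_of_le {i n : ℕ} (h : n ≤ i) (a : ↥(I ^ i)) :
    gradedClass I i a ∈ irrelevantIdeal I ^ n :=
  Ideal.pow_le_pow_right h (gradedClass_mem_irrelevantIdeal_pow I i a a.2)

theorem irrelevantIdeal_pow_le (n : ℕ) : irrelevantIdeal I ^ n ≤
    Ideal.span {g | ∃ i, n ≤ i ∧ ∃ a : ↥(I ^ i), g = gradedClass I i a} := by
  induction n with
  | zero =>
    rw [pow_zero, Ideal.one_eq_top, top_le_iff, Ideal.eq_top_iff_one]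
    refine Ideal.subset_span ⟨0, le_rfl, ⟨1, by simp⟩, ?_⟩
    rw [← algebraMap_eq_gradedClass, map_one]
  | succ n ih =>
    rw [pow_succ]
    refine (mul_le_mul' ih le_rfl).trans ?_
    rw [irrelevantIdeal, Ideal.span_mul_span', Ideal.span_le]
    rintro _ ⟨_, ⟨i, hi, a, rfl⟩, _, ⟨j, hj, b, rfl⟩, rfl⟩
    exact Ideal.subset_span ⟨i + j, by omega, _, gradedClass_mul I i j a b⟩

theorem irrelevantIdeal_pow_sup_gradedBelow (n : ℕ) :
    (irrelevantIdeal I ^ n).restrictScalars R ⊔ gradedBelow I n = ⊤ := by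
  rw [eq_top_iff, ← iSup_range_gradedClass I]
  refine iSup_le fun i => ?_
  rintro _ ⟨a, rfl⟩
  rcases lt_or_ge i n with h | h
  · exact Submodule.mem_sup_right (gradedClass_mem_gradedBelow I h a)
  · exact Submodule.mem_sup_left (gradedClass_mem_irrelevantIdeal_pow_of_le I h a)

theorem length_quotient_irrelevantIdeal_pow_le (n : ℕ) :
    Module.length (AssocGraded I) (AssocGraded I ⧸ irrelevantIdeal I ^ n) ≤
      Module.length R (R ⧸ I ^ n) := by
  rw [← relLength_top]
  refine (relLength_le_restrictScalars R _ _).trans ?_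
  rw [Submodule.restrictScalars_top, ← irrelevantIdeal_pow_sup_gradedBelow I n, relLength_sup]
  exact (relLength_anti_left bot_le _).trans (relLength_gradedBelow_le I n)

/-- If `R / I ^ n` has length `O(n ^ e)`, then `gr_I(R)` has dimension at most `e`. -/
theorem ringKrullDim_assocGraded_le {C e : ℕ}
    (hC : ∀ n : ℕ, Module.length R (R ⧸ I ^ n) ≤ C * (n : ℕ∞) ^ e) :
    ringKrullDim (AssocGraded I) ≤ e := by
  refine ringKrullDim_le_of_filtration (gradedBelow I) (gradedBelow_mono I) ?_
    (gradedBelow_mul_le I) (exists_mem_gradedBelow I) (C := C)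
    fun n => (relLength_gradedBelow_le I n).trans (hC n)
  have h : (1 : AssocGraded I) = gradedClass I 0 ⟨1, by simp⟩ := by
    rw [← algebraMap_eq_gradedClass, map_one]
  rw [h]
  exact gradedClass_mem_gradedBelow I one_pos _

end Graded

section InitialModule

variable {R : Type*} [CommRing R] (I : Ideal R) {r : ℕ}

theorem compLeft_gradedClass_mem_initialModule {E : Submodule R (Fin r → R)} {i : ℕ}
    (v : Fin r → ↥(I ^ i)) (hv : (fun k => (v k : R)) ∈ E) :
    (gradedClass I i).compLeft (Fin r) v ∈ initialModule I E :=
  Submodule.subset_span ⟨i, v, hv, rfl⟩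

theorem mem_smul_top_iff (J : Ideal R) (v : Fin r → R) :
    v ∈ J • (⊤ : Submodule R (Fin r → R)) ↔ ∀ k, v k ∈ J := by
  constructor
  · intro hv k
    refine Submodule.smul_induction_on hv (fun a ha w _ => ?_) (fun v w hv hw => ?_)
    · exact J.mul_mem_right _ ha
    · exact add_mem hv hw
  · intro hv
    rw [pi_eq_sum_univ' v]
    exact Submodule.sum_mem _ fun k _ => Submodule.smul_mem_smul (hv k) trivial

theorem irrelevantIdeal_pow_smul_top_le_initialModule {E : Submodule R (Fin r → R)} {k : ℕ}
    (hE : I ^ k • ⊤ ≤ E) : irrelevantIdeal I ^ k • ⊤ ≤ initialModule I E := by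
  intro w hw
  rw [mem_smul_top_iff] at hw
  rw [← LinearMap.sum_single_apply (fun _ => AssocGraded I) w]
  refine Submodule.sum_mem _ fun l _ => ?_
  have h : irrelevantIdeal I ^ k ≤ (initialModule I E).comap
      (LinearMap.single (AssocGraded I) (fun _ : Fin r => AssocGraded I) l) := by
    refine (irrelevantIdeal_pow_le I k).trans (Ideal.span_le.mpr ?_)
    rintro _ ⟨i, hi, a, rfl⟩
    have h1 := compLeft_gradedClass_mem_initialModule I (E := E) (Pi.single l a) (hE (by
      rw [mem_smul_top_iff]
      intro j
      rcases eq_or_ne j l with rfl | hj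
      · simpa using Ideal.pow_le_pow_right hi a.2
      · simp [Pi.single_eq_of_ne hj]))
    change (Pi.single l (gradedClass I i a) : Fin r → AssocGraded I) ∈ initialModule I E
    convert h1 using 1
    funext j
    rcases eq_or_ne j l with rfl | hj
    · simp
    · simp [Pi.single_eq_of_ne hj]
  exact h (hw l)

/-- The length of `gr_I(F) / E^*` is at most that of `F / E`: the part of degree `i` of the first is
the image of `E + I ^ i F` modulo `E + I ^ (i + 1) F`. -/
theorem length_quotient_initialModule_le {E : Submodule R (Fin r → R)} {k : ℕ}
    (hE : I ^ k • ⊤ ≤ E) :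
    Module.length (AssocGraded I) ((Fin r → AssocGraded I) ⧸ initialModule I E) ≤
      Module.length R ((Fin r → R) ⧸ E) := by
  rw [← relLength_top, ← relLength_top]
  refine (relLength_le_restrictScalars R _ _).trans ?_
  rw [Submodule.restrictScalars_top]
  let cls : ∀ i, (Fin r → ↥(I ^ i)) →ₗ[R] (Fin r → AssocGraded I) := fun i =>
    (gradedClass I i).compLeft (Fin r)
  let inc : ∀ i, (Fin r → ↥(I ^ i)) →ₗ[R] (Fin r → R) := fun i =>
    (Submodule.subtype (I ^ i)).compLeft (Fin r)
  have hinc : ∀ i, LinearMap.range (inc i) = I ^ i • ⊤ := fun i => by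
    ext v
    rw [mem_smul_top_iff]
    refine ⟨?_, fun hv => ⟨fun j => ⟨v j, hv j⟩, rfl⟩⟩
    rintro ⟨w, rfl⟩ j
    exact (w j).2
  let W : ℕ → Submodule R (Fin r → AssocGraded I) := fun n =>
    (initialModule I E).restrictScalars R ⊔ ⨆ i, ⨆ _ : i < n, LinearMap.range (cls i)
  have hW0 : W 0 = (initialModule I E).restrictScalars R := by simp [W]
  have hcls : ∀ n i, i < n → LinearMap.range (cls i) ≤ W n := fun n i hi =>
    le_sup_of_le_right (le_iSup₂_of_le (f := fun i (_ : i < n) => LinearMap.range (cls i))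
      i hi le_rfl)
  have hWs : ∀ n, W (n + 1) ≤ W n ⊔ LinearMap.range (cls n) := fun n => by
    refine sup_le (le_sup_left.trans le_sup_left) (iSup₂_le fun i hi => ?_)
    rcases Nat.lt_succ_iff_lt_or_eq.mp hi with h | rfl
    · exact (hcls n i h).trans le_sup_left
    · exact le_sup_right
  have hWmono : ∀ n, W n ≤ W (n + 1) := fun n =>
    sup_le le_sup_left (iSup₂_le fun i hi => hcls _ i (hi.trans n.lt_succ_self))
  have hWtop : W k = ⊤ := by
    rw [eq_top_iff]
    intro w _
    have hmem : ∀ i, LinearMap.range (cls i) ≤ W k := fun i => by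
      rcases lt_or_ge i k with h | h
      · exact hcls k i h
      · rintro _ ⟨v, rfl⟩
        refine Submodule.mem_sup_left (compLeft_gradedClass_mem_initialModule I v (hE ?_))
        rw [mem_smul_top_iff]
        exact fun j => Ideal.pow_le_pow_right h (v j).2
    rw [← LinearMap.sum_single_apply (fun _ => AssocGraded I) w]
    refine Submodule.sum_mem _ fun l _ => ?_
    have hl : (⨆ i, LinearMap.range (gradedClass I i)) ≤
        (W k).comap (LinearMap.single R (fun _ : Fin r => AssocGraded I) l) := by
      refine iSup_le fun i => ?_
      rintro _ ⟨a, rfl⟩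
      refine hmem i ⟨Pi.single l a, ?_⟩
      funext j
      rcases eq_or_ne j l with rfl | hj
      · simp [cls]
      · simp [cls, Pi.single_eq_of_ne hj]
    exact hl (by simp [iSup_range_gradedClass])
  have hstep : ∀ n, relLength (W 0) (W n) ≤ relLength (E ⊔ I ^ n • ⊤) ⊤ := by
    intro n
    induction n with
    | zero => simp [relLength_self]
    | succ n ih =>
      have h1 : E ⊔ I ^ (n + 1) • ⊤ ≤ E ⊔ I ^ n • (⊤ : Submodule R (Fin r → R)) :=
        sup_le_sup_left (Submodule.smul_mono_left (Ideal.pow_le_pow_right n.le_succ)) _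
      have hW0n : W 0 ≤ W n := monotone_nat_of_le_succ hWmono (Nat.zero_le n)
      rw [← relLength_add hW0n (hWmono n), ← relLength_add h1 le_top, add_comm]
      refine add_le_add ?_ ih
      have h2 : relLength (E ⊔ I ^ (n + 1) • ⊤) (E ⊔ I ^ n • ⊤) =
          relLength ((E ⊔ I ^ (n + 1) • ⊤).comap (inc n)) ⊤ := by
        have := relLength_inf_comap (inc n) ⊤ (E ⊔ I ^ (n + 1) • ⊤)
        rw [top_inf_eq, ← LinearMap.range_eq_map, hinc] at this
        rw [this]
        congr 1
        refine le_antisymm (sup_le (le_sup_left.trans le_sup_left) le_sup_right)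
          (sup_le h1 le_sup_right)
      rw [h2]
      refine relLength_le_of_map (cls n) ?_ (by rw [← LinearMap.range_eq_map]; exact hWs n)
      rintro _ ⟨v, hv, rfl⟩
      obtain ⟨x, hx, u, hu, hxu⟩ := Submodule.mem_sup.mp hv
      rw [mem_smul_top_iff] at hu
      have hu' : ∀ j, u j ∈ I ^ n := fun j => Ideal.pow_le_pow_right n.le_succ (hu j)
      have hv' : cls n v = cls n (v - fun j => ⟨u j, hu' j⟩) := by
        rw [map_sub, eq_comm, sub_eq_self]
        funext j
        exact gradedClass_eq_zero_of_mem I _ (hu j)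
      rw [hv']
      refine Submodule.mem_sup_left (compLeft_gradedClass_mem_initialModule I _ ?_)
      convert hx using 1
      rw [eq_comm, ← sub_eq_iff_eq_add.mpr hxu.symm]
      rfl
  rw [← hW0, ← hWtop]
  refine (hstep k).trans ?_
  rw [sup_eq_left.mpr hE]

end InitialModule

/-! ### Leading forms in polynomial rings -/

section LeadingForms

variable {R : Type*} [CommRing R] (I : Ideal R) (σ : Type*)

/-- The reduction map from polynomials over the Rees algebra `R[It]` to polynomials over
`gr_I(R)`. -/
noncomputable def reesToGraded :
    MvPolynomial σ (reesAlgebra I) →+* MvPolynomial σ (AssocGraded I) :=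
  MvPolynomial.map (AssocGraded.mk I)

/-- A polynomial over `R[It]`, seen as a polynomial in `t` whose coefficients are polynomials
over `R`. -/
noncomputable def reesExpand :
    MvPolynomial σ (reesAlgebra I) →+* Polynomial (MvPolynomial σ R) :=
  MvPolynomial.eval₂Hom
    ((Polynomial.mapRingHom MvPolynomial.C).comp (reesAlgebra I).subtype)
    (fun i => Polynomial.C (MvPolynomial.X i))

variable {σ}

theorem reesExpand_C (c : reesAlgebra I) :
    reesExpand I σ (MvPolynomial.C c) =
      (c : Polynomial R).map (MvPolynomial.C : R →+* MvPolynomial σ R) := by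
  simp only [reesExpand, MvPolynomial.coe_eval₂Hom, MvPolynomial.eval₂_C]
  rfl

theorem reesExpand_X (i : σ) :
    reesExpand I σ (MvPolynomial.X i) = Polynomial.C (MvPolynomial.X i) := by
  simp [reesExpand]

theorem coeff_reesExpand (p : MvPolynomial σ (reesAlgebra I)) (j : ℕ) (s : σ →₀ ℕ) :
    ((reesExpand I σ p).coeff j).coeff s =
      ((p.coeff s : reesAlgebra I) : Polynomial R).coeff j := by
  classical
  induction p using MvPolynomial.induction_on generalizing s with
  | C c =>
    rw [reesExpand_C, Polynomial.coeff_map, MvPolynomial.coeff_C, MvPolynomial.coeff_C]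
    split_ifs <;> simp
  | add p q hp hq => simp [hp, hq]
  | mul_X p i hp =>
    rw [map_mul, reesExpand_X, Polynomial.coeff_mul_C, MvPolynomial.coeff_mul_X',
      MvPolynomial.coeff_mul_X']
    split_ifs
    · exact hp _
    · simp

/-- Every polynomial with coefficients in `I ^ i` lifts to the Rees algebra in degree `i`. -/
theorem exists_reesExpand_eq_monomial {i : ℕ} {f : MvPolynomial σ R}
    (hf : ∀ s, f.coeff s ∈ I ^ i) : ∃ p, reesExpand I σ p = Polynomial.monomial i f := by
  classical
  refine ⟨∑ s ∈ f.support, MvPolynomial.monomial s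
    ⟨Polynomial.monomial i (f.coeff s), reesAlgebra.monomial_mem.mpr (hf s)⟩, ?_⟩
  ext j s
  rw [coeff_reesExpand, MvPolynomial.coeff_sum, Polynomial.coeff_monomial]
  simp only [MvPolynomial.coeff_monomial, Finset.sum_ite_eq']
  split_ifs with h1 h2 h2
  · rw [Polynomial.coeff_monomial, if_pos h2]
  · rw [Polynomial.coeff_monomial, if_neg h2, MvPolynomial.coeff_zero]
  · rw [MvPolynomial.notMem_support_iff.mp h1]
    simp
  · simp

/-- For a submodule `Q` of a polynomial ring over `R`, the module of leading forms of `Q` with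
respect to the `I`-adic filtration of the coefficients, as a `gr_I(R)`-submodule of the polynomial
ring over `gr_I(R)`. It consists of the reductions of those polynomials over `R[It]` whose
coefficients at the powers of `t` all lie in `Q`. -/
noncomputable def leadingForms (Q : Submodule R (MvPolynomial σ R)) :
    Submodule (AssocGraded I) (MvPolynomial σ (AssocGraded I)) where
  carrier := {w | ∃ p, reesToGraded I σ p = w ∧ ∀ j, (reesExpand I σ p).coeff j ∈ Q}
  add_mem' := by
    rintro _ _ ⟨p, rfl, hp⟩ ⟨q, rfl, hq⟩
    refine ⟨p + q, map_add _ _ _, fun j => ?_⟩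
    rw [map_add, Polynomial.coeff_add]
    exact add_mem (hp j) (hq j)
  zero_mem' := ⟨0, map_zero _, fun j => by simp⟩
  smul_mem' := by
    rintro g _ ⟨p, rfl, hp⟩
    obtain ⟨c, rfl⟩ := assocGraded_mk_surjective I g
    refine ⟨MvPolynomial.C c * p, ?_, fun j => ?_⟩
    · rw [map_mul, MvPolynomial.smul_eq_C_mul, reesToGraded, MvPolynomial.map_C]
    · rw [map_mul, reesExpand_C, Polynomial.coeff_mul]
      refine Submodule.sum_mem _ fun x _ => ?_
      rw [Polynomial.coeff_map, ← MvPolynomial.smul_eq_C_mul]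
      exact Q.smul_mem _ (hp _)

variable {I}

theorem leadingForms_mono {Q Q' : Submodule R (MvPolynomial σ R)} (h : Q ≤ Q') :
    leadingForms I Q ≤ leadingForms I Q' := fun _ ⟨p, hp, hQ⟩ => ⟨p, hp, fun j => h (hQ j)⟩

theorem leadingForms_mul_le (Q Q' : Submodule R (MvPolynomial σ R)) :
    leadingForms I Q * leadingForms I Q' ≤ leadingForms I (Q * Q') := by
  rw [Submodule.mul_le]
  rintro _ ⟨p, rfl, hp⟩ _ ⟨q, rfl, hq⟩
  refine ⟨p * q, map_mul _ _ _, fun j => ?_⟩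
  rw [map_mul, Polynomial.coeff_mul]
  exact Submodule.sum_mem _ fun x _ => Submodule.mul_mem_mul (hp _) (hq _)

theorem one_le_leadingForms_one :
    1 ≤ leadingForms I (1 : Submodule R (MvPolynomial σ R)) := by
  rw [Submodule.one_le]
  refine ⟨1, map_one _, fun j => ?_⟩
  rw [map_one, Polynomial.coeff_one]
  split_ifs
  · exact Submodule.one_le.mp le_rfl
  · exact zero_mem _

theorem leadingForms_pow_le (Q : Submodule R (MvPolynomial σ R)) (n : ℕ) :
    leadingForms I Q ^ n ≤ leadingForms I (Q ^ n) := by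
  induction n with
  | zero =>
    rw [pow_zero, pow_zero]
    exact one_le_leadingForms_one
  | succ n ih =>
    rw [pow_succ, pow_succ]
    exact (mul_le_mul' ih le_rfl).trans (leadingForms_mul_le _ _)

theorem leadingForms_homogeneousSubmodule_le (n : ℕ) :
    leadingForms I (MvPolynomial.homogeneousSubmodule σ R n) ≤
      MvPolynomial.homogeneousSubmodule σ (AssocGraded I) n := by
  rintro _ ⟨p, rfl, hp⟩
  rw [MvPolynomial.mem_homogeneousSubmodule]
  intro s hs
  by_contra hdeg
  refine hs ?_
  rw [reesToGraded, MvPolynomial.coeff_map]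
  have : p.coeff s = 0 := by
    ext j
    rw [← coeff_reesExpand]
    have := hp j
    rw [MvPolynomial.mem_homogeneousSubmodule] at this
    by_contra hne
    exact hdeg (this hne)
  rw [this, map_zero]

/-- Submodules with the same leading forms agree up to arbitrarily high powers of `I`. -/
theorem exists_coeff_sub_mem_pow {X Y : Submodule R (MvPolynomial σ R)} (hXY : X ≤ Y)
    (h : leadingForms I Y ≤ leadingForms I X) {f : MvPolynomial σ R} (hf : f ∈ Y) (i : ℕ) :
    ∃ x ∈ X, ∀ s, (f - x).coeff s ∈ I ^ i := by
  induction i with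
  | zero => exact ⟨0, zero_mem _, by simp⟩
  | succ i ih =>
    obtain ⟨x, hx, hxs⟩ := ih
    obtain ⟨p, hp⟩ := exists_reesExpand_eq_monomial I hxs
    have hpY : reesToGraded I σ p ∈ leadingForms I Y := by
      refine ⟨p, rfl, fun j => ?_⟩
      rw [hp, Polynomial.coeff_monomial]
      split_ifs
      · exact sub_mem hf (hXY hx)
      · exact zero_mem _
    obtain ⟨q, hq, hqX⟩ := h hpY
    refine ⟨x + (reesExpand I σ q).coeff i, add_mem hx (hqX i), fun s => ?_⟩
    have h1 : AssocGraded.mk I ((p - q).coeff s) = 0 := by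
      rw [← MvPolynomial.coeff_map]
      change (reesToGraded I σ (p - q)).coeff s = 0
      rw [map_sub, hq, sub_self, MvPolynomial.coeff_zero]
    have h2 := coeff_mem_of_mk_eq_zero h1 i
    rw [← coeff_reesExpand, map_sub, hp, Polynomial.coeff_sub, Polynomial.coeff_monomial,
      if_pos rfl] at h2
    rwa [← sub_sub]

/-- Passing to leading forms is strictly monotone on the submodules between `N` and `H`, so that
lengths over `R` are bounded by lengths over `gr_I(R)`. -/
theorem relLength_le_of_leadingForms {N H : Submodule R (MvPolynomial σ R)} (hNH : N ≤ H)
    {N' H' : Submodule (AssocGraded I) (MvPolynomial σ (AssocGraded I))} {k : ℕ}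
    (hN : ∀ f ∈ H, (∀ s, f.coeff s ∈ I ^ k) → f ∈ N)
    (hN' : N' ≤ leadingForms I N) (hH' : leadingForms I H ≤ H') :
    relLength N H ≤ relLength N' H' := by
  refine relLength_le_of_strictMono hNH (leadingForms I)
    (fun X h1 h2 => ⟨hN'.trans (leadingForms_mono h1), (leadingForms_mono h2).trans hH'⟩)
    (fun X Y _ h _ => leadingForms_mono h) ?_
  intro X Y hNX hXY hYH h f hf
  obtain ⟨x, hx, hxs⟩ := exists_coeff_sub_mem_pow hXY h hf k
  have h1 : f - x ∈ X := hNX (hN _ (sub_mem (hYH hf) (hYH (hXY hx))) hxs)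
  simpa using add_mem h1 hx

end LeadingForms

section ColengthComparison

variable {R : Type*} [CommRing R] (I : Ideal R)

/-- The lengths of the powers of `I` are bounded by those of the powers of the irrelevant ideal. -/
theorem length_quotient_pow_le (n : ℕ) : Module.length R (R ⧸ I ^ n) ≤
    Module.length (AssocGraded I) (AssocGraded I ⧸ irrelevantIdeal I ^ n) := by
  let P : ℕ → Submodule R (MvPolynomial (Fin 0) R) := fun n =>
    Submodule.map (Algebra.linearMap R (MvPolynomial (Fin 0) R)) (I ^ n)
  let P' : Submodule (AssocGraded I) (MvPolynomial (Fin 0) (AssocGraded I)) :=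
    Submodule.map (Algebra.linearMap (AssocGraded I) _) (irrelevantIdeal I ^ n)
  have hC : ∀ n, ∀ g ∈ irrelevantIdeal I ^ n, (MvPolynomial.C g : MvPolynomial (Fin 0) _) ∈
      leadingForms I (P n) := by
    intro n
    have hle : irrelevantIdeal I ^ n ≤ (leadingForms I (P n)).comap
        (Algebra.linearMap (AssocGraded I) (MvPolynomial (Fin 0) (AssocGraded I))) := by
      refine (irrelevantIdeal_pow_le I n).trans (Ideal.span_le.mpr ?_)
      rintro _ ⟨i, hi, a, rfl⟩
      refine ⟨MvPolynomial.C ⟨Polynomial.monomial i (a : R), reesAlgebra.monomial_mem.mpr a.2⟩,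
        MvPolynomial.map_C _ _, fun j => ?_⟩
      rw [reesExpand_C, Polynomial.map_monomial, Polynomial.coeff_monomial]
      split_ifs
      · exact ⟨a, Ideal.pow_le_pow_right hi a.2, rfl⟩
      · exact zero_mem _
    exact hle
  have h1 : relLength (I ^ n) ⊤ ≤ relLength (P n) ⊤ := by
    refine relLength_le_of_map (MvPolynomial.isEmptyAlgEquiv R (Fin 0)).toLinearMap ?_ ?_
    · rintro _ ⟨_, ⟨a, ha, rfl⟩, rfl⟩
      have : MvPolynomial.isEmptyAlgEquiv R (Fin 0) (algebraMap R _ a) = a :=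
        AlgEquiv.commutes _ a
      change MvPolynomial.isEmptyAlgEquiv R (Fin 0) (algebraMap R _ a) ∈ I ^ n
      rwa [this]
    · exact fun a _ => Submodule.mem_sup_right
        ⟨(MvPolynomial.isEmptyAlgEquiv R (Fin 0)).symm a, trivial,
          (MvPolynomial.isEmptyAlgEquiv R (Fin 0)).apply_symm_apply a⟩
  have h2 : relLength P' ⊤ ≤ relLength (irrelevantIdeal I ^ n) ⊤ := by
    refine relLength_le_of_map (Algebra.linearMap (AssocGraded I) _) le_rfl fun f _ =>
      Submodule.mem_sup_right ?_
    obtain ⟨a, rfl⟩ := MvPolynomial.C_surjective (Fin 0) f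
    exact ⟨a, trivial, rfl⟩
  rw [← relLength_top, ← relLength_top]
  refine (h1.trans ?_).trans h2
  refine relLength_le_of_leadingForms le_top (k := n) ?_ ?_ le_top
  · intro f _ hf
    obtain ⟨a, rfl⟩ := MvPolynomial.C_surjective (Fin 0) f
    exact ⟨a, by simpa using hf 0, rfl⟩
  · rintro _ ⟨g, hg, rfl⟩
    exact hC n g hg

/-- A vector, as a linear form. -/
noncomputable def linearForm (A : Type*) [CommRing A] (r : ℕ) :
    (Fin r → A) →ₗ[A] MvPolynomial (Fin r) A :=
  Fintype.linearCombination A MvPolynomial.X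

theorem linearForm_apply {A : Type*} [CommRing A] {r : ℕ} (v : Fin r → A) :
    linearForm A r v = ∑ k, MvPolynomial.C (v k) * MvPolynomial.X k := by
  simp [linearForm, Fintype.linearCombination_apply, MvPolynomial.smul_eq_C_mul]

theorem range_linearForm (A : Type*) [CommRing A] (r : ℕ) :
    LinearMap.range (linearForm A r) = MvPolynomial.homogeneousSubmodule (Fin r) A 1 := by
  rw [linearForm, Fintype.range_linearCombination, MvPolynomial.homogeneousSubmodule_one_eq_span_X]

/-- The length of `F ^ n / E ^ n`, computed in the polynomial ring. -/
theorem reesColength_eq_relLength_linearForm {A : Type*} [CommRing A] {r : ℕ}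
    (E : Submodule A (Fin r → A)) (n : ℕ) :
    reesColength E n = relLength (E.map (linearForm A r) ^ n)
      (MvPolynomial.homogeneousSubmodule (Fin r) A n) := by
  let e := SymmetricAlgebra.equivMvPolynomial (Pi.basisFun A (Fin r))
  have he : e.toLinearMap ∘ₗ SymmetricAlgebra.ι A (Fin r → A) = linearForm A r := by
    refine (Pi.basisFun A (Fin r)).ext fun i => ?_
    rw [LinearMap.comp_apply]
    change e _ = _
    rw [SymmetricAlgebra.equivMvPolynomial_ι_apply, Pi.basisFun_apply, linearForm,
      Fintype.linearCombination_apply_single, one_smul]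
  rw [reesColength_eq_relLength, ← relLength_map_equiv e.toLinearEquiv,
    ← MvPolynomial.homogeneousSubmodule_one_pow, ← range_linearForm, ← he, LinearMap.range_comp,
    Submodule.map_comp]
  congr 1
  · exact Submodule.map_pow _ e.toAlgHom n
  · exact Submodule.map_pow _ e.toAlgHom n

theorem linearForm_mem_leadingForms {r : ℕ} {E : Submodule R (Fin r → R)}
    {w : Fin r → AssocGraded I} (hw : w ∈ irrelevantIdeal I • initialModule I E) :
    linearForm (AssocGraded I) r w ∈ leadingForms I ((I • E).map (linearForm R r)) := by
  suffices h : irrelevantIdeal I • initialModule I E ≤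
      (leadingForms I ((I • E).map (linearForm R r))).comap (linearForm (AssocGraded I) r) from h hw
  rw [irrelevantIdeal, initialModule, Submodule.span_smul_span, Submodule.span_le]
  intro x hx
  obtain ⟨_, ⟨i, hi, a, rfl⟩, _, ⟨j, v, hv, rfl⟩, rfl⟩ := hx
  -- the linear form with coefficients `a v` times `t ^ (i + j)`
  refine ⟨∑ l, MvPolynomial.C (⟨Polynomial.monomial i (a : R), reesAlgebra.monomial_mem.mpr a.2⟩ *
    ⟨Polynomial.monomial j (v l : R), reesAlgebra.monomial_mem.mpr (v l).2⟩) *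
      MvPolynomial.X l, ?_, fun n => ?_⟩
  · rw [map_sum, linearForm_apply]
    refine Finset.sum_congr rfl fun l _ => ?_
    rw [map_mul]
    congr 1
    · refine (MvPolynomial.map_C _ _).trans ?_
      rw [map_mul]
      rfl
    · exact MvPolynomial.map_X _ _
  · have h : reesExpand I (Fin r) (∑ l, MvPolynomial.C
        (⟨Polynomial.monomial i (a : R), reesAlgebra.monomial_mem.mpr a.2⟩ *
          ⟨Polynomial.monomial j (v l : R), reesAlgebra.monomial_mem.mpr (v l).2⟩) *
        MvPolynomial.X l) = Polynomial.monomial (i + j)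
          (linearForm R r ((a : R) • fun l => (v l : R))) := by
      rw [map_sum, linearForm_apply, map_sum]
      refine Finset.sum_congr rfl fun l _ => ?_
      rw [map_mul, reesExpand_C, reesExpand_X, MulMemClass.coe_mul,
        Polynomial.monomial_mul_monomial, Polynomial.map_monomial, Polynomial.monomial_mul_C]
      rfl
    rw [h, Polynomial.coeff_monomial]
    split_ifs
    · refine ⟨_, Submodule.smul_mem_smul ?_ hv, rfl⟩
      exact Ideal.pow_le_self (by omega) a.2
    · exact zero_mem _

/-- The colength of `(I E) ^ n` is at most that of `(G₊ E^*) ^ n`, since the latter module is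
contained in the module of leading forms of the former. -/
theorem reesColength_le {r : ℕ} {E : Submodule R (Fin r → R)} {k : ℕ} (hE : I ^ k • ⊤ ≤ E)
    (n : ℕ) :
    reesColength (I • E) n ≤ reesColength (irrelevantIdeal I • initialModule I E) n := by
  rw [reesColength_eq_relLength_linearForm, reesColength_eq_relLength_linearForm]
  have hsmul : I ^ (k + 1) • MvPolynomial.homogeneousSubmodule (Fin r) R 1 ≤
      (I • E).map (linearForm R r) := by
    rw [← range_linearForm, LinearMap.range_eq_map, ← Submodule.map_smul'', pow_succ',
      mul_smul]
    exact Submodule.map_mono (Submodule.smul_mono le_rfl hE)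
  refine relLength_le_of_leadingForms (k := (k + 1) * n) ?_ ?_ ?_
    (leadingForms_homogeneousSubmodule_le n)
  · rw [← MvPolynomial.homogeneousSubmodule_one_pow, ← range_linearForm]
    exact pow_le_pow_left' LinearMap.map_le_range n
  · intro f hf hfs
    refine smul_pow_le I (k + 1) hsmul n ?_
    rw [MvPolynomial.homogeneousSubmodule_one_pow, f.as_sum]
    refine Submodule.sum_mem _ fun s hs => ?_
    have h1 : MvPolynomial.monomial s (f.coeff s) =
        f.coeff s • MvPolynomial.monomial s (1 : R) := by
      rw [MvPolynomial.smul_monomial, smul_eq_mul, mul_one]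
    rw [h1]
    refine Submodule.smul_mem_smul (hfs s) (MvPolynomial.isHomogeneous_monomial _ ?_)
    rw [Finsupp.degree_eq_weight_one]
    exact hf (MvPolynomial.mem_support_iff.mp hs)
  · refine (pow_le_pow_left' ?_ n).trans (leadingForms_pow_le _ n)
    rintro _ ⟨w, hw, rfl⟩
    exact linearForm_mem_leadingForms I hw

end ColengthComparison

/-! ### Multiplicities of a local ring and of its associated graded ring -/

theorem toENNReal_div_mono {f g : ℕ∞} (h : f ≤ g) (c n : ℝ≥0∞) :
    c * (f : ℝ≥0∞) / n ≤ c * (g : ℝ≥0∞) / n :=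
  ENNReal.div_le_div_right (mul_le_mul' le_rfl (ENat.toENNReal_le.mpr h)) _

theorem isBuchsbaumRimMultiplicity_le {A B : Type*} [CommRing A] [CommRing B] {r d : ℕ}
    (hA : ringKrullDim A = d) (hB : ringKrullDim B = d) {E : Submodule A (Fin r → A)}
    {E' : Submodule B (Fin r → B)} (h : ∀ n, reesColength E n ≤ reesColength E' n) {b b' : ℝ≥0}
    (hb : IsBuchsbaumRimMultiplicity E b) (hb' : IsBuchsbaumRimMultiplicity E' b') : b ≤ b' := by
  obtain ⟨d₁, h₁, t₁⟩ := hb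
  obtain ⟨d₂, h₂, t₂⟩ := hb'
  obtain rfl : d₁ = d := by exact_mod_cast h₁.symm.trans hA
  obtain rfl : d₂ = d₁ := by exact_mod_cast h₂.symm.trans hB
  exact_mod_cast le_of_tendsto_of_tendsto' t₁ t₂ fun n => toENNReal_div_mono (h n) _ _

theorem isHilbertSamuelMultiplicity_le {A B : Type*} [CommRing A] [CommRing B] {d : ℕ}
    (hA : ringKrullDim A = d) (hB : ringKrullDim B = d) {I : Ideal A} {J : Ideal B}
    (h : ∀ n, Module.length A (A ⧸ I ^ n) ≤ Module.length B (B ⧸ J ^ n)) {e e' : ℝ≥0}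
    (he : IsHilbertSamuelMultiplicity I e) (he' : IsHilbertSamuelMultiplicity J e') : e ≤ e' := by
  obtain ⟨d₁, h₁, t₁⟩ := he
  obtain ⟨d₂, h₂, t₂⟩ := he'
  obtain rfl : d₁ = d := by exact_mod_cast h₁.symm.trans hA
  obtain rfl : d₂ = d₁ := by exact_mod_cast h₂.symm.trans hB
  exact_mod_cast le_of_tendsto_of_tendsto' t₁ t₂ fun n => toENNReal_div_mono (h n) _ _

section Local

open IsLocalRing

variable {R : Type*} [CommRing R] [IsLocalRing R]

theorem exists_maximalIdeal_pow_smul_top_le {M : Type*} [AddCommGroup M] [Module R M]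
    (E : Submodule R M) (hE : Module.length R (M ⧸ E) ≠ ⊤) :
    ∃ k, maximalIdeal R ^ k • ⊤ ≤ E := by
  obtain ⟨hN, hA⟩ := isFiniteLength_iff_isNoetherian_isArtinian.mp (Module.length_ne_top_iff.mp hE)
  obtain ⟨k, hk⟩ := IsArtinian.monotone_stabilizes
    ({ toFun := fun n => OrderDual.toDual (maximalIdeal R ^ n • (⊤ : Submodule R (M ⧸ E)))
       monotone' := fun a b hab => Submodule.smul_mono_left (Ideal.pow_le_pow_right hab) } :
      ℕ →o (Submodule R (M ⧸ E))ᵒᵈ)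
  have h1 : maximalIdeal R ^ k • (⊤ : Submodule R (M ⧸ E)) =
      maximalIdeal R ^ (k + 1) • (⊤ : Submodule R (M ⧸ E)) := hk (k + 1) (Nat.le_succ k)
  have h2 : maximalIdeal R ^ k • (⊤ : Submodule R (M ⧸ E)) = ⊥ := by
    refine Submodule.eq_bot_of_le_smul_of_le_jacobson_bot (maximalIdeal R) _
      (IsNoetherian.noetherian _) ?_ (IsLocalRing.jacobson_eq_maximalIdeal ⊥ bot_ne_top).ge
    rw [← mul_smul, ← pow_succ']
    exact h1.le
  refine ⟨k, ?_⟩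
  rw [← Submodule.ker_mkQ E, LinearMap.le_ker_iff_map, Submodule.map_smul'', eq_bot_iff, ← h2]
  exact Submodule.smul_mono le_rfl le_top

instance isMaximal_irrelevantIdeal [IsNoetherianRing R] :
    (irrelevantIdeal (maximalIdeal R)).IsMaximal := by
  have h1 : Module.length R (R ⧸ maximalIdeal R) = 1 := Module.length_eq_one_iff.mpr
    (isSimpleModule_iff_isCoatom.mpr (Ideal.isMaximal_def.mp inferInstance))
  have h2 := length_quotient_pow_le (maximalIdeal R) 1
  have h3 := length_quotient_irrelevantIdeal_pow_le (maximalIdeal R) 1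
  rw [pow_one, pow_one, h1] at h2 h3
  exact Ideal.isMaximal_def.mpr (isSimpleModule_iff_isCoatom.mp
    (Module.length_eq_one_iff.mp (le_antisymm h3 h2)))

variable [IsNoetherianRing R] {d : ℕ}

theorem exists_length_quotient_maximalIdeal_pow_le (hd : ringKrullDim R = d) :
    ∃ C : ℕ, ∀ n : ℕ, Module.length R (R ⧸ maximalIdeal R ^ n) ≤ C * (n : ℕ∞) ^ d := by
  refine exists_length_quotient_maximal_pow_le (maximalIdeal R) ?_
  have h := maximalIdeal_height_eq_ringKrullDim (R := R)
  rw [hd] at h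
  exact_mod_cast h

/-- The associated graded ring of a Noetherian local ring `R` has the same dimension as `R`, since
both dimensions are the order of growth of the length of `R / m ^ n`. -/
theorem ringKrullDim_assocGraded (hd : ringKrullDim R = d) :
    ringKrullDim (AssocGraded (maximalIdeal R)) = d := by
  obtain ⟨C, hC⟩ := exists_length_quotient_maximalIdeal_pow_le hd
  have hle := ringKrullDim_assocGraded_le (maximalIdeal R) hC
  refine le_antisymm hle ?_
  have hht : ((irrelevantIdeal (maximalIdeal R)).height : WithBot ℕ∞) ≤
      ringKrullDim (AssocGraded (maximalIdeal R)) := Ideal.height_le_ringKrullDim_of_isPrime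
  obtain ⟨s, hs⟩ := ENat.ne_top_iff_exists.mp (ne_top_of_le_ne_top (ENat.natCast_ne_top d)
    (by exact_mod_cast hht.trans hle))
  obtain ⟨C', hC'⟩ := exists_length_quotient_maximal_pow_le _ hs.symm
  have h := ringKrullDim_le_of_length_quotient_pow_le (R := R)
    fun n => (length_quotient_pow_le (maximalIdeal R) n).trans (hC' n)
  rw [hd] at h
  rw [← hs] at hht
  exact h.trans hht

end Local

end BuchsbaumRim

open IsLocalRing in
theorem proposition3p1 {R : Type*} [CommRing R] [IsLocalRing R] [IsNoetherianRing R]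
    (d r : ℕ) (hd : ringKrullDim R = d) (E : Submodule R (Fin r → R))
    (hE : Module.length R ((Fin r → R) ⧸ E) ≠ ⊤) :
    ∃ bR bG eR eG : ℝ≥0,
      IsBuchsbaumRimMultiplicity (maximalIdeal R • E) bR ∧
      IsBuchsbaumRimMultiplicity
        (irrelevantIdeal (maximalIdeal R) • initialModule (maximalIdeal R) E) bG ∧
      IsHilbertSamuelMultiplicity (maximalIdeal R) eR ∧
      IsHilbertSamuelMultiplicity (irrelevantIdeal (maximalIdeal R)) eG ∧
      bR ≤ bG ∧
      ((bG : ℝ≥0∞) < ((d + r - 1)! : ℝ≥0∞) / (r ! : ℝ≥0∞) *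
          (Module.length (AssocGraded (maximalIdeal R))
            ((Fin r → AssocGraded (maximalIdeal R)) ⧸ initialModule (maximalIdeal R) E) : ℝ≥0∞) *
          (eG : ℝ≥0∞) →
        (bR : ℝ≥0∞) < ((d + r - 1)! : ℝ≥0∞) / (r ! : ℝ≥0∞) *
          (Module.length R ((Fin r → R) ⧸ E) : ℝ≥0∞) * (eR : ℝ≥0∞)) := by
  open BuchsbaumRim in
  have hd' := ringKrullDim_assocGraded hd
  obtain ⟨k, hk⟩ := exists_maximalIdeal_pow_smul_top_le E hE
  obtain ⟨C, hC⟩ := exists_length_quotient_maximalIdeal_pow_le hd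
  have hC' : ∀ n : ℕ, Module.length (AssocGraded (maximalIdeal R))
      (AssocGraded (maximalIdeal R) ⧸ irrelevantIdeal (maximalIdeal R) ^ n) ≤
        C * (n : ℕ∞) ^ d :=
    fun n => (length_quotient_irrelevantIdeal_pow_le _ n).trans (hC n)
  have hmE : maximalIdeal R ^ (k + 1) • ⊤ ≤ maximalIdeal R • E := by
    rw [pow_succ', mul_smul]
    exact Submodule.smul_mono le_rfl hk
  have hmE' : irrelevantIdeal (maximalIdeal R) ^ (k + 1) • ⊤ ≤
      irrelevantIdeal (maximalIdeal R) • initialModule (maximalIdeal R) E := by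
    rw [pow_succ', mul_smul]
    exact Submodule.smul_mono le_rfl (irrelevantIdeal_pow_smul_top_le_initialModule _ hk)
  obtain ⟨bR, hbR⟩ := exists_isBuchsbaumRimMultiplicity _ hmE hd hC
  obtain ⟨bG, hbG⟩ := exists_isBuchsbaumRimMultiplicity _ hmE' hd' hC'
  obtain ⟨eR, heR⟩ := exists_isHilbertSamuelMultiplicity _ hd hC
  obtain ⟨eG, heG⟩ := exists_isHilbertSamuelMultiplicity _ hd' hC'
  have hb : bR ≤ bG :=
    isBuchsbaumRimMultiplicity_le hd hd' (reesColength_le _ hk) hbR hbG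
  have he : eG ≤ eR :=
    isHilbertSamuelMultiplicity_le hd' hd (length_quotient_irrelevantIdeal_pow_le _) heG heR
  refine ⟨bR, bG, eR, eG, hbR, hbG, heR, heG, hb, fun h => ?_⟩
  refine (ENNReal.coe_le_coe.mpr hb).trans_lt (h.trans_le ?_)
  gcongr
  exact length_quotient_initialModule_le _ hk
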